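/- Let $a_0>a_1>\dots>a_n>0$ and let $A$ be a positive $C^\infty$ function on $[a_n,a_0]$ such that $\tilde A(\lambda)=(\lambda-a_n)A(\lambda)$ satisfies $(-1)^k\tilde A^{(k)}>0$ on $[a_n,a_0]$ for $2\le k\le n$. For $1\le i\le n$ put $\alpha_i=2\int_{a_i}^{a_{i-1}}A(\lambda)\big((-1)^i\prod_{j=0}^n(\lambda-a_j)\big)^{-1/2}d\lambda$, and let $f_i$ be the $C^\infty$ function on $\mathbb R/\alpha_i\mathbb Z$ determined by $$\Big(\frac{df_i}{dx_i}\Big)^2=\frac{(-1)^i\,4\prod_{j=0}^n(f_i-a_j)}{A(f_i)^2},\quad f_i(0)=a_i,\quad f_i\big(\tfrac{\alpha_i}4\big)=a_{i-1},\quad f_i(-x_i)=f_i(x_i)=f_i\big(\tfrac{\alpha_i}2-x_i\big).$$ Let $R=\prod_{i=1}^n\mathbb R/\alpha_i\mathbb Z$, and let $M=R/G$, where $G$ is generated by the involutions $\tau_k$ $(1\le k\le n-1)$ which send $x_k$ to $-x_k$ and $x_{k+1}$ to $\alpha_{k+1}/2-x_{k+1}$ and fix the other coordinates. Give $M$ the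 Riemannian metric $$g=\sum_{i=1}^n(-1)^{n-i}\Big(\prod_{l\ne i}(f_l(x_l)-f_i(x_i))\Big)dx_i^2 .$$ For $1\le j\le n-1$ let $F_j$ be the first integral of the geodesic flow given on $T^*M$ by $$F_j(x,\xi)=\frac1{\prod_{1\le k\le n-1,\,k\ne j}(a_k-a_j)}\sum_{i=1}^n\frac{(-1)^{n-i}\prod_{l\ne i}(f_l(x_l)-a_j)}{\prod_{l\ne i}(f_l(x_l)-f_i(x_i))}\,\xi_i^2 .$$ Let $\gamma(t)=(x_1(t),\dots,x_n(t))$, $t\in\mathbb R$, be a unit speed geodesic of $M$. Let $c_j$ be the value of $F_j$ at its unit covector, and let $b_1\ge\dots\ge b_{n-1}$ be the constants with $$\sum_{j=1}^{n-1}\Big(\prod_{1\le k\le n-1,\,k\ne j}(\lambda-a_k)\Big)c_j-\prod_{k=1}^{n-1}(\lambda-a_k)=-\prod_{i=1}^{n-1}(\lambda-b_i).$$ Put $a_i^+=\max\{a_i,b_i\}$ and $a_i^-=\min\{a_i,b_i\}$ for $1\le i\le n-1$, and $a_n^+=a_n$, $a_0^-=a_0$. For $1\le i\le n$ let $\sigma_i(t)=\int_0^t\big|\frac{d}{ds}f_i(x_i(s))\big|\,ds$,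 and let $t_i$ be the half-period time defined by $\sigma_i(t_i)=2(a_{i-1}^--a_i^+)$. If the constants $b_1,\dots,b_{n-1},a_0,\dots,a_n$ are all distinct, then $t_n<t_{n-1}<\dots<t_1$. -/

import Mathlib

open scoped ContDiff

/-- The index set `{1, …, n}` of the coordinates. -/
abbrev Idx (n : ℕ) : Type := {i : ℕ // i ∈ Finset.Icc 1 n}

/-- Constants `a_0 > a_1 > … > a_n > 0` (only the values `a 0, …, a n` matter) and a positive
`C^∞` function `A` on `[a_n, a_0]`. -/
structure LiouvilleData (n : ℕ) where
  a : ℕ → ℝ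
  A : ℝ → ℝ
  a_lt : ∀ i, i < n → a (i + 1) < a i
  a_pos : 0 < a n
  A_pos : ∀ r ∈ Set.Icc (a n) (a 0), 0 < A r
  A_smooth : ContDiffOn ℝ ∞ A (Set.Icc (a n) (a 0))

namespace LiouvilleData

variable {n : ℕ}

/-- The period `α_i = 2 ∫_{a_i}^{a_{i-1}} A(r) dr / √((-1)^i ∏_{j=0}^n (r - a_j))`. -/
noncomputable def period (D : LiouvilleData n) (i : ℕ) : ℝ :=
  2 * ∫ r in (D.a i)..(D.a (i - 1)),
    D.A r / Real.sqrt ((-1) ^ i * ∏ j ∈ Finset.range (n + 1), (r - D.a j))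

/-- The monotonicity condition: `Ã(r) = (r - a_n) A(r)` satisfies `(-1)^k Ã^{(k)} > 0` on
`[a_n, a_0]` for `2 ≤ k ≤ n`. -/
def MonotonicityCondition (D : LiouvilleData n) : Prop :=
  ∀ k : ℕ, 2 ≤ k → k ≤ n → ∀ r ∈ Set.Icc (D.a n) (D.a 0),
    0 < (-1 : ℝ) ^ k *
      iteratedDerivWithin k (fun s => (s - D.a n) * D.A s) (Set.Icc (D.a n) (D.a 0)) r

end LiouvilleData

/-- The data of a Liouville manifold: the constants `a_i`, the function `A`, and the functions
`f_1, …, f_n` which they determine. The function `f_i` on the circle `ℝ / α_i ℤ` is written as a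
function on `ℝ`; the last two conditions make it periodic with period `α_i / 2`. -/
structure LiouvilleManifold (n : ℕ) extends LiouvilleData n where
  f : ℕ → ℝ → ℝ
  f_smooth : ∀ i ∈ Finset.Icc 1 n, ContDiff ℝ ∞ (f i)
  f_ode : ∀ i ∈ Finset.Icc 1 n, ∀ y : ℝ, deriv (f i) y ^ 2 =
    (-1) ^ i * 4 * (∏ j ∈ Finset.range (n + 1), (f i y - a j)) / A (f i y) ^ 2
  f_zero : ∀ i ∈ Finset.Icc 1 n, f i 0 = a i
  f_quarter : ∀ i ∈ Finset.Icc 1 n, f i (toLiouvilleData.period i / 4) = a (i - 1)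
  f_neg : ∀ i ∈ Finset.Icc 1 n, ∀ y : ℝ, f i (-y) = f i y
  f_half_sub : ∀ i ∈ Finset.Icc 1 n, ∀ y : ℝ, f i (toLiouvilleData.period i / 2 - y) = f i y

namespace LiouvilleManifold

variable {n : ℕ}

theorem f_periodic (D : LiouvilleManifold n) (i : Idx n) :
    Function.Periodic (D.f i) (D.period i) := by
  have h : ∀ y, D.f i (D.period i / 2 + y) = D.f i y := fun y => by
    have := D.f_half_sub i i.2 (-y)
    rwa [sub_neg_eq_add, D.f_neg i i.2] at this
  intro y
  have e : y + D.period i = D.period i / 2 + (D.period i / 2 + y) := by ring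
  rw [e, h, h]

/-- The torus `R = ∏_{i=1}^n ℝ / α_i ℤ`. -/
abbrev Torus (D : LiouvilleManifold n) : Type := (i : Idx n) → AddCircle (D.period i)

/-- The involution `τ_k`, which sends `x_k` to `-x_k`, sends `x_{k+1}` to `α_{k+1}/2 - x_{k+1}`,
and fixes the other coordinates. -/
noncomputable def tau (D : LiouvilleManifold n) (k : ℕ) (p : D.Torus) : D.Torus := fun i =>
  if (i : ℕ) = k then -p i
  else if (i : ℕ) = k + 1 then ((D.period i / 2 : ℝ) : AddCircle (D.period i)) - p i
  else p i

/-- The space `M = R / G`, where `G` is the group generated by `τ_1, …, τ_{n-1}`: the quotient of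
`R` by the equivalence relation which is generated by `p ∼ τ_k p`. -/
def Space (D : LiouvilleManifold n) : Type :=
  Quot fun p q : D.Torus => ∃ k ∈ Finset.Icc 1 (n - 1), q = D.tau k p

/-- The point of `M` with the coordinates `(x_1, …, x_n)`, i.e. the composite
`ℝ^n → R → M`. -/
noncomputable def proj (D : LiouvilleManifold n) (x : Idx n → ℝ) : D.Space :=
  Quot.mk _ fun i => (x i : AddCircle (D.period i))

theorem lift_tau (D : LiouvilleManifold n) (i : Idx n) (k : ℕ) (p : D.Torus) :
    (D.f_periodic i).lift (D.tau k p i) = (D.f_periodic i).lift (p i) := by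
  obtain ⟨y, hy⟩ := QuotientAddGroup.mk_surjective (p i)
  have hy' : p i = (y : AddCircle (D.period i)) := hy.symm
  unfold tau
  split_ifs
  · rw [hy', ← AddCircle.coe_neg, Function.Periodic.lift_coe, Function.Periodic.lift_coe]
    exact D.f_neg i i.2 y
  · rw [hy', ← AddCircle.coe_sub, Function.Periodic.lift_coe, Function.Periodic.lift_coe]
    exact D.f_half_sub i i.2 y
  · rfl

/-- The function `f_i(x_i)` as a function on `M`. -/
noncomputable def coordFun (D : LiouvilleManifold n) (i : Idx n) : D.Space → ℝ :=
  Quot.lift (fun p => (D.f_periodic i).lift (p i)) (by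
    rintro p q ⟨k, -, rfl⟩
    exact (D.lift_tau i k p).symm)

theorem coordFun_proj (D : LiouvilleManifold n) (i : Idx n) (x : Idx n → ℝ) :
    D.coordFun i (D.proj x) = D.f i (x i) := rfl

/-- The point `x` does not lie on the branch locus of the covering `R → M`, which is the set where
`f_k(x_k) = f_{k+1}(x_{k+1})` (`= a_k`) for some `1 ≤ k ≤ n - 1`. -/
def Regular (D : LiouvilleManifold n) (x : Idx n → ℝ) : Prop :=
  ∀ i j : Idx n, (j : ℕ) = i + 1 → D.f i (x i) ≠ D.f j (x j)

/-- The coefficient of `dx_i²` in the metric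
`g = ∑_i (-1)^{n-i} (∏_{l ≠ i} (f_l(x_l) - f_i(x_i))) dx_i²`. Off the branch locus all the
coefficients are positive. -/
def metricCoeff (D : LiouvilleManifold n) (x : Idx n → ℝ) (i : Idx n) : ℝ :=
  (-1) ^ (n - (i : ℕ)) * ∏ l ∈ Finset.univ.erase i, (D.f l (x l) - D.f i (x i))

/-- The energy function `E = (1/2) ∑ g^{ij} ξ_i ξ_j` on the cotangent bundle. -/
noncomputable def energy (D : LiouvilleManifold n) (x ξ : Idx n → ℝ) : ℝ :=
  (1 / 2) * ∑ i, ξ i ^ 2 / D.metricCoeff x i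

/-- The first integrals `F_j`, `1 ≤ j ≤ n - 1`, on the cotangent bundle. -/
noncomputable def firstIntegral (D : LiouvilleManifold n) (j : ℕ) (x ξ : Idx n → ℝ) : ℝ :=
  1 / (∏ k ∈ (Finset.Icc 1 (n - 1)).erase j, (D.a k - D.a j)) *
    ∑ i : Idx n, (-1) ^ (n - (i : ℕ)) * (∏ l ∈ Finset.univ.erase i, (D.f l (x l) - D.a j)) /
      (∏ l ∈ Finset.univ.erase i, (D.f l (x l) - D.f i (x i))) * ξ i ^ 2

/-- `b_1 ≥ … ≥ b_{n-1}` are the constants of the unit covector `(x, ξ)`: they are the zeros of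
`Θ(r) = ∑_j (∏_{k ≠ j} (r - a_k)) c_j - ∏_k (r - a_k)`, where `c_j = F_j(x, ξ)`. Only the values
`b 1, …, b (n - 1)` matter. -/
def HasConstants (D : LiouvilleManifold n) (x ξ : Idx n → ℝ) (b : ℕ → ℝ) : Prop :=
  (∀ i, 1 ≤ i → i + 1 ≤ n - 1 → b (i + 1) ≤ b i) ∧
  ∀ r : ℝ, ∑ j ∈ Finset.Icc 1 (n - 1),
      (∏ k ∈ (Finset.Icc 1 (n - 1)).erase j, (r - D.a k)) * D.firstIntegral j x ξ
        - ∏ k ∈ Finset.Icc 1 (n - 1), (r - D.a k)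
      = -∏ i ∈ Finset.Icc 1 (n - 1), (r - b i)

/-- `γ` is the projection to `M` of the continuous curve `x`, and whenever `x(t)` is off the branch
locus, `(x, ξ)` satisfies Hamilton's equations
`x_i' = ∂E/∂ξ_i`, `ξ_i' = -∂E/∂x_i` of the geodesic flow at the time `t`, with `2E = 1`.

Every unit speed geodesic `γ : ℝ → M` has such a lift. Conversely, off the branch locus `R → M` is
a local isometry, so that `γ` is a geodesic there. Nothing is asked at times when `γ` meets the
branch locus; this never happens if the constants of `γ` are distinct from all the `a_i`. -/
structure IsGeodesicLift (D : LiouvilleManifold n) (γ : ℝ → D.Space) (x ξ : ℝ → Idx n → ℝ) :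
    Prop where
  proj_eq : ∀ t, γ t = D.proj (x t)
  continuous : Continuous x
  unit_speed : ∀ t, D.Regular (x t) → 2 * D.energy (x t) (ξ t) = 1
  hamilton_x : ∀ t, D.Regular (x t) → ∀ i, HasDerivAt (fun s => x s i)
    (deriv (fun y => D.energy (x t) (Function.update (ξ t) i y)) (ξ t i)) t
  hamilton_ξ : ∀ t, D.Regular (x t) → ∀ i, HasDerivAt (fun s => ξ s i)
    (-deriv (fun y => D.energy (Function.update (x t) i y) (ξ t)) (x t i)) t

/-- `γ` is a unit speed geodesic of `M` which starts off the branch locus and whose initial unit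
covector has the constants `b_1, …, b_{n-1}`. (If a geodesic starts on the branch locus, then one
of its constants is equal to some `a_k`.) -/
def IsGeodesicWithConstants (D : LiouvilleManifold n) (γ : ℝ → D.Space) (b : ℕ → ℝ) : Prop :=
  ∃ x ξ : ℝ → Idx n → ℝ, D.IsGeodesicLift γ x ξ ∧ D.Regular (x 0) ∧ D.HasConstants (x 0) (ξ 0) b

/-- `a_i^+ = max {a_i, b_i}` for `1 ≤ i ≤ n - 1`, and `a_n^+ = a_n`. -/
noncomputable def aPlus (D : LiouvilleManifold n) (b : ℕ → ℝ) (i : ℕ) : ℝ :=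
  if i = n then D.a n else max (D.a i) (b i)

/-- `a_i^- = min {a_i, b_i}` for `1 ≤ i ≤ n - 1`, and `a_0^- = a_0`. -/
noncomputable def aMinus (D : LiouvilleManifold n) (b : ℕ → ℝ) (i : ℕ) : ℝ :=
  if i = 0 then D.a 0 else min (D.a i) (b i)

/-- The total variation `σ_i(t) = ∫_0^t |d f_i(x_i(s)) / ds| ds` along the curve `γ`. -/
noncomputable def totalVariation (D : LiouvilleManifold n) (γ : ℝ → D.Space) (i : Idx n)
    (t : ℝ) : ℝ :=
  ∫ s in (0 : ℝ)..t, |deriv (fun r => D.coordFun i (γ r)) s|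

/-- `t` is the half-period time `t_i` of `γ`: `σ_i(t) = 2 (a_{i-1}^- - a_i^+)`. -/
def IsHalfPeriod (D : LiouvilleManifold n) (γ : ℝ → D.Space) (b : ℕ → ℝ) (i : Idx n)
    (t : ℝ) : Prop :=
  D.totalVariation γ i t = 2 * (D.aMinus b ((i : ℕ) - 1) - D.aPlus b i)

end LiouvilleManifold

/-! Put `p l = a_l^+` and `q l = a_{l-1}^-`. Separation of variables gives `ξ_l² = (-1)^l Θ(f_l)`
along the geodesic, with `Θ(r) = -∏ (r - b_k)`. Hence `f_l(x_l)` oscillates in `[p l, q l]`. Since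
the constants are distinct, these intervals are disjoint and the ends are simple turning points. So
`f_l(x_l) = (p l + q l)/2 + (q l - p l)/2 * cos φ_l` with a strictly increasing phase `φ_l`, and
`t_l` is the time at which `φ_l` has advanced by `2π` (`IsGeodesicLift.conserved`,
`IsGeodesicLift.exists_phase`, `phase_of_isHalfPeriod`).

Two families of linear relations hold for polynomials of degree at most `n - 2`. Along the geodesic,
partial fractions at the values `f_l(x_l)` give `∑ (-1)^l ∫ G A / √(gapFactor) dφ_l = 0` over any
time interval. Over half turns, without the weight `A`, `∑ (-1)^l ∫_0^π B / √(gapFactor) dθ = 0`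
(`sum_period_eq_zero`): the pencil `(1 - τ) ∏ (x - p k) + τ ∏ (x - q k)` has one root in each
interval, and taking `τ` as common variable reduces this to partial fractions at the roots.

The monotonicity condition enters through interpolation. For `N ⊆ {1, …, n}` with at least two
elements, let `G` have the zeros `a_k`, `k ∉ N`, and interpolate `Ã` at the `a_k`, `k ∈ N`. The
remainder shows that `G A` differs from a polynomial of degree at most `n - 2` by a function of
known sign on every interval. So the alternating sum of the half-turn integrals of `G A` has the
strict sign `-(-1)^|N|` (`sum_weighted_period_sign`).

Suppose `t_i ≤ t_{i+1}`. At time `t_i`, phase `i` has made exactly one turn and phase `i + 1` at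
most one. Let `N` consist of the indices where the answer to "at most one turn?" changes, with `i`
counted as a no. Then `(-1)^|N| (-1)^l G` has on each interval the sign that makes the integral over
the missing part of the turn nonnegative. By the relation along the geodesic, the alternating sum of
these integrals is the sum over full turns, whose strict sign is opposite
(`phase_order_contradiction`). -/

/-- A product of differences has the sign which is given by the number of nodes on the right. -/
theorem prod_sub_sign {ι : Type*} [LinearOrder ι] {s : Finset ι} {x : ℝ} {c : ι → ℝ} {l : ι}
    (h₁ : ∀ k ∈ s, k < l → x < c k) (h₂ : ∀ k ∈ s, l ≤ k → c k < x) :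
    0 < (-1) ^ (s.filter (· < l)).card * ∏ k ∈ s, (x - c k) := by
  have h : (-1 : ℝ) ^ (s.filter (· < l)).card = ∏ k ∈ s, if k < l then (-1 : ℝ) else 1 := by
    simp [Finset.prod_ite]
  rw [h, ← Finset.prod_mul_distrib]
  refine Finset.prod_pos fun k hk => ?_
  split_ifs with h
  · linarith [h₁ k hk h]
  · linarith [h₂ k hk (not_lt.1 h)]

theorem prod_sub_sign_le {ι : Type*} [LinearOrder ι] {s : Finset ι} {x : ℝ} {c : ι → ℝ} {l : ι}
    (h₁ : ∀ k ∈ s, k < l → x ≤ c k) (h₂ : ∀ k ∈ s, l ≤ k → c k ≤ x) :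
    0 ≤ (-1) ^ (s.filter (· < l)).card * ∏ k ∈ s, (x - c k) := by
  have h : (-1 : ℝ) ^ (s.filter (· < l)).card = ∏ k ∈ s, if k < l then (-1 : ℝ) else 1 := by
    simp [Finset.prod_ite]
  rw [h, ← Finset.prod_mul_distrib]
  refine Finset.prod_nonneg fun k hk => ?_
  split_ifs with h
  · linarith [h₁ k hk h]
  · linarith [h₂ k hk (not_lt.1 h)]

theorem card_filter_Icc_lt {n l : ℕ} (hl : 1 ≤ l) (hn : l ≤ n + 1) :
    ((Finset.Icc 1 n).filter (· < l)).card = l - 1 := by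
  have : (Finset.Icc 1 n).filter (· < l) = Finset.Icc 1 (l - 1) := by
    ext k; simp only [Finset.mem_filter, Finset.mem_Icc]; omega
  rw [this, Nat.card_Icc]; omega

/-! ### Polynomial interpolation with remainder -/

open Polynomial in
/-- Rolle's theorem for the higher derivatives of the difference of a function and a polynomial. -/
theorem exists_iteratedDerivWithin_eq_iterate_derivative {a b : ℝ} (hab : a < b) (M : ℕ) :
    ∀ (F : ℝ → ℝ) (R : ℝ[X]) (e : Fin (M + 1) → ℝ), ContDiffOn ℝ M F (Set.Icc a b) →
      StrictMono e → (∀ i, e i ∈ Set.Icc a b) → (∀ i, F (e i) = R.eval (e i)) →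
      ∃ z ∈ Set.Icc a b,
        iteratedDerivWithin M F (Set.Icc a b) z = (derivative^[M] R).eval z := by
  induction M with
  | zero =>
    intro F R e _ _ he hF
    exact ⟨e 0, he 0, by simpa using hF 0⟩
  | succ M ih =>
    intro F R e hd hmono he hF
    have hu : UniqueDiffOn ℝ (Set.Icc a b) := uniqueDiffOn_Icc hab
    have key : ∀ i : Fin (M + 1), ∃ z ∈ Set.Ioo (e i.castSucc) (e i.succ),
        derivWithin F (Set.Icc a b) z = (derivative R).eval z := by
      intro i
      have hlt : e i.castSucc < e i.succ := hmono (Fin.castSucc_lt_succ)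
      have hsub : Set.Icc (e i.castSucc) (e i.succ) ⊆ Set.Icc a b :=
        Set.Icc_subset_Icc (he _).1 (he _).2
      obtain ⟨z, hz, hz0⟩ := exists_deriv_eq_zero (f := fun x => F x - R.eval x) hlt
        ((hd.continuousOn.mono hsub).sub R.continuous.continuousOn) (by simp [hF])
      have hzI : z ∈ Set.Ioo a b := ⟨(he _).1.trans_lt hz.1, hz.2.trans_le (he _).2⟩
      have hnhds : Set.Icc a b ∈ nhds z := Icc_mem_nhds hzI.1 hzI.2
      have hdF : DifferentiableAt ℝ F z :=
        ((hd.differentiableOn (by simp)) z (Set.Ioo_subset_Icc_self hzI)).differentiableAt hnhds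
      refine ⟨z, hz, ?_⟩
      rw [deriv_fun_sub hdF R.differentiableAt, Polynomial.deriv] at hz0
      rw [derivWithin_of_mem_nhds hnhds]
      linarith
    choose z hz hzeq using key
    have hzmono : StrictMono z := by
      intro i j hij
      have : e i.succ ≤ e j.castSucc := hmono.monotone (by
        rw [Fin.le_iff_val_le_val]; simpa using hij)
      exact (hz i).2.trans_le (this.trans (hz j).1.le)
    have hd' : ContDiffOn ℝ M (derivWithin F (Set.Icc a b)) (Set.Icc a b) :=
      hd.derivWithin hu (by norm_cast)
    obtain ⟨w, hw, hw'⟩ := ih (derivWithin F (Set.Icc a b)) (derivative R) z hd' hzmono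
      (fun i => ⟨(he _).1.trans (hz i).1.le, (hz i).2.le.trans (he _).2⟩) hzeq
    refine ⟨w, hw, ?_⟩
    rw [iteratedDerivWithin_succ', hw', Function.iterate_succ_apply]

open Polynomial in
/-- The remainder of polynomial interpolation. -/
theorem exists_eq_interpolate_add {a b : ℝ} (hab : a < b) {F : ℝ → ℝ} {s : Finset ℕ} {v : ℕ → ℝ}
    (hF : ContDiffOn ℝ s.card F (Set.Icc a b)) (hv : Set.InjOn v s)
    (hmem : ∀ k ∈ s, v k ∈ Set.Icc a b) {x : ℝ} (hx : x ∈ Set.Icc a b) :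
    ∃ z ∈ Set.Icc a b, F x = (Lagrange.interpolate s v (fun k => F (v k))).eval x +
      iteratedDerivWithin s.card F (Set.Icc a b) z / s.card.factorial * ∏ k ∈ s, (x - v k) := by
  set p := Lagrange.interpolate s v (fun k => F (v k)) with hp
  by_cases hxs : ∃ k ∈ s, x = v k
  · obtain ⟨k, hk, rfl⟩ := hxs
    refine ⟨_, hmem k hk, ?_⟩
    rw [Finset.prod_eq_zero hk (sub_self _), mul_zero, add_zero, hp,
      Lagrange.eval_interpolate_at_node _ hv hk]
  push Not at hxs
  have hprod : ∏ k ∈ s, (x - v k) ≠ 0 :=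
    Finset.prod_ne_zero_iff.2 fun k hk => sub_ne_zero.2 (hxs k hk)
  -- This `K` makes `R` agree with `F` at the extra point `x` as well. That gives `s.card + 1`
  -- agreements, and the `s.card`-th derivative of `R` is the constant `s.card! * K`.
  set K := (F x - p.eval x) / ∏ k ∈ s, (x - v k) with hK
  set R : ℝ[X] := p + C K * Lagrange.nodal s v with hR
  have hcard : (insert x (s.image v)).card = s.card + 1 := by
    rw [Finset.card_insert_of_notMem, Finset.card_image_of_injOn hv]
    simp only [Finset.mem_image, not_exists, not_and]
    exact fun k hk h => hxs k hk h.symm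
  set e := (insert x (s.image v)).orderEmbOfFin hcard with he
  have heq : ∀ y ∈ insert x (s.image v), y ∈ Set.Icc a b ∧ F y = R.eval y := by
    intro y hy
    rcases Finset.mem_insert.1 hy with rfl | hy
    · refine ⟨hx, ?_⟩
      simp only [hR, eval_add, eval_mul, eval_C, Lagrange.eval_nodal, hK]
      field_simp
      ring
    · obtain ⟨k, hk, rfl⟩ := Finset.mem_image.1 hy
      refine ⟨hmem k hk, ?_⟩
      rw [hR, eval_add, eval_mul, Lagrange.eval_nodal_at_node hk, hp,
        Lagrange.eval_interpolate_at_node _ hv hk, mul_zero, add_zero]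
  obtain ⟨z, hz, hz'⟩ := exists_iteratedDerivWithin_eq_iterate_derivative hab s.card F R e hF
    e.strictMono (fun i => (heq _ (Finset.orderEmbOfFin_mem _ _ _)).1)
    (fun i => (heq _ (Finset.orderEmbOfFin_mem _ _ _)).2)
  have hpdeg : p.degree < s.card := Lagrange.degree_interpolate_lt _ hv
  have hcoeff : R.coeff s.card = K := by
    have h1 : p.coeff s.card = 0 := coeff_eq_zero_of_degree_lt hpdeg
    have h2 : (Lagrange.nodal s v).coeff s.card = 1 := by
      have := (Lagrange.nodal_monic (s := s) (v := v)).coeff_natDegree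
      rwa [Lagrange.natDegree_nodal] at this
    simp [hR, h1, h2]
  have hRdeg : R.natDegree ≤ s.card := by
    refine natDegree_add_le_of_degree_le (natDegree_le_of_degree_le hpdeg.le) ?_
    exact (natDegree_C_mul_le _ _).trans Lagrange.natDegree_nodal.le
  have hconst : derivative^[s.card] R = C ((s.card.factorial : ℝ) * K) := by
    have h0 : (derivative^[s.card] R).natDegree = 0 := by
      have := natDegree_iterate_derivative R s.card
      omega
    rw [eq_C_of_natDegree_eq_zero h0, coeff_iterate_derivative, zero_add, hcoeff,
      Nat.descFactorial_self, nsmul_eq_mul]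
  refine ⟨z, hz, ?_⟩
  rw [hz', hconst, eval_C]
  have : (s.card.factorial : ℝ) ≠ 0 := by positivity
  rw [hK]
  field_simp
  ring

/-! ### Partial fractions and polynomials with interlacing zeros -/

section Interlacing

open Polynomial

variable {n : ℕ}

theorem Idx.card_filter_lt (l : Idx n) :
    ((Finset.univ : Finset (Idx n)).filter (· < l)).card = (l : ℕ) - 1 := by
  have hl := Finset.mem_Icc.1 l.2
  rw [← card_filter_Icc_lt (n := n) hl.1 (by omega),
    ← Finset.card_map (Function.Embedding.subtype _)]
  congr 1
  ext k
  simp only [Finset.mem_map, Finset.mem_filter, Finset.mem_univ, true_and]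
  constructor
  · rintro ⟨y, hy, rfl⟩
    exact ⟨y.2, hy⟩
  · rintro ⟨hk, hkl⟩
    exact ⟨⟨k, hk⟩, hkl, rfl⟩

theorem Idx.card_filter_le (l : Idx n) :
    ((Finset.univ : Finset (Idx n)).filter (· ≤ l)).card = l := by
  have hl := Finset.mem_Icc.1 l.2
  have : (Finset.univ : Finset (Idx n)).filter (· ≤ l) =
      insert l ((Finset.univ : Finset (Idx n)).filter (· < l)) := by
    ext k; simp [le_iff_eq_or_lt]
  rw [this, Finset.card_insert_of_notMem (by simp), Idx.card_filter_lt]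
  omega

theorem Idx.card_filter_erase_lt (l : Idx n) :
    (((Finset.univ : Finset (Idx n)).erase l).filter (· < l)).card = (l : ℕ) - 1 := by
  rw [← Idx.card_filter_lt]
  congr 1
  ext k
  simp only [Finset.mem_filter, Finset.mem_erase, Finset.mem_univ, and_true, true_and,
    and_iff_right_iff_imp]
  exact fun h => h.ne

theorem Idx.card_univ : (Finset.univ : Finset (Idx n)).card = n := by
  rw [Finset.card_univ, Fintype.card_coe, Nat.card_Icc]; omega

theorem neg_one_pow_mul_pos_of_sub_one {l : ℕ} (hl : 1 ≤ l) {x : ℝ} (h : 0 < (-1) ^ (l - 1) * x) :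
    (-1) ^ l * x < 0 := by
  obtain ⟨k, rfl⟩ := Nat.exists_eq_add_of_le' hl
  rw [Nat.add_sub_cancel] at h
  rw [pow_succ]; linarith

theorem prod_erase_sub_sign {y : Idx n → ℝ} (hy : StrictAnti y) (l : Idx n) :
    (-1) ^ (l : ℕ) * ∏ k ∈ Finset.univ.erase l, (y l - y k) < 0 := by
  have := prod_sub_sign (s := Finset.univ.erase l) (x := y l) (c := y) (l := l)
    (fun k _ h => hy h) (fun k hk h => hy (lt_of_le_of_ne h (Finset.ne_of_mem_erase hk).symm))
  rw [Idx.card_filter_erase_lt] at this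
  exact neg_one_pow_mul_pos_of_sub_one (Finset.mem_Icc.1 l.2).1 this

theorem abs_eq_neg_of_sign {l : ℕ} {x : ℝ} (h : (-1) ^ l * x < 0) : |x| = -((-1) ^ l * x) := by
  rw [← abs_of_neg h, abs_mul, abs_pow, abs_neg, abs_one, one_pow, one_mul]

/-- Partial fractions: the sum which annihilates polynomials of low degree. -/
theorem sum_eval_div_abs_eq_zero {y : Idx n → ℝ} (hy : StrictAnti y) {B : ℝ[X]}
    (hB : B.degree < (n - 1 : ℕ)) :
    ∑ l : Idx n, (-1) ^ (l : ℕ) * (B.eval (y l) /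
      |∏ k ∈ Finset.univ.erase l, (y l - y k)|) = 0 := by
  have hdeg : B.degree < (Finset.univ : Finset (Idx n)).card := by
    rw [Idx.card_univ]
    exact hB.trans_le (by exact_mod_cast Nat.sub_le n 1)
  -- The unsigned partial fraction sum is the coefficient of degree `n - 1`, which is zero. The
  -- decreasing order of the nodes turns the sign of each node product into `-(-1)^l`.
  have h := Lagrange.coeff_eq_sum (s := Finset.univ) (v := y) hy.injective.injOn hdeg
  rw [Idx.card_univ, coeff_eq_zero_of_degree_lt hB] at h
  rw [← neg_eq_zero, ← Finset.sum_neg_distrib, h]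
  refine Finset.sum_congr rfl fun l _ => ?_
  have hs := prod_erase_sub_sign hy l
  rw [abs_eq_neg_of_sign hs]
  have h0 : ∏ k ∈ Finset.univ.erase l, (y l - y k) ≠ 0 := fun h0 => by
    rw [h0, mul_zero] at hs; exact hs.false
  have h1 : ((-1 : ℝ) ^ (l : ℕ)) ≠ 0 := by simp
  field_simp

variable {p q : Idx n → ℝ}

theorem prod_lower_sign (hpq : ∀ l, p l < q l) (hsep : ∀ k l, k < l → q l < p k)
    {l : Idx n} {x : ℝ} (hx : x ∈ Set.Ioc (p l) (q l)) :
    (-1) ^ (l : ℕ) * ∏ k, (x - p k) < 0 := by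
  have := prod_sub_sign (s := Finset.univ) (x := x) (c := p) (l := l)
    (fun k _ h => hx.2.trans_lt (hsep k l h)) (fun k _ h => ?_)
  · rw [Idx.card_filter_lt] at this
    exact neg_one_pow_mul_pos_of_sub_one (Finset.mem_Icc.1 l.2).1 this
  · rcases h.eq_or_lt with rfl | h
    · exact hx.1
    · exact ((hpq k).trans (hsep l k h)).trans hx.1

/-- Here the factor `k = l` is negative too, one more than in `prod_lower_sign`. So the two endpoint
products have opposite signs inside every interval, which is what makes the pencil work. -/
theorem prod_upper_sign (hpq : ∀ l, p l < q l) (hsep : ∀ k l, k < l → q l < p k)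
    {l : Idx n} {x : ℝ} (hx : x ∈ Set.Ico (p l) (q l)) :
    0 < (-1) ^ (l : ℕ) * ∏ k, (x - q k) := by
  have h : (-1 : ℝ) ^ (l : ℕ) = ∏ k : Idx n, if k ≤ l then (-1 : ℝ) else 1 := by
    rw [Finset.prod_ite]
    rw [Finset.prod_const, Finset.prod_const_one, mul_one, Idx.card_filter_le]
  rw [h, ← Finset.prod_mul_distrib]
  refine Finset.prod_pos fun k _ => ?_
  split_ifs with hk
  · rcases hk.eq_or_lt with rfl | hk
    · linarith [hx.2]
    · linarith [hx.2, hsep k l hk, hpq k]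
  · linarith [hx.1, hsep l k (not_le.1 hk)]

theorem gap_factor_pos (hpq : ∀ l, p l < q l) (hsep : ∀ k l, k < l → q l < p k)
    (l : Idx n) {x : ℝ} (hx : x ∈ Set.Icc (p l) (q l)) :
    0 < ∏ k ∈ Finset.univ.erase l, (x - p k) * (x - q k) := by
  refine Finset.prod_pos fun k hk => ?_
  rcases lt_or_gt_of_ne (Finset.ne_of_mem_erase hk) with h | h
  · have h1 := hsep k l h
    have h2 := hpq k
    exact mul_pos_of_neg_of_neg (by linarith [hx.2]) (by linarith [hx.2])
  · have h1 := hsep l k h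
    have h2 := hpq k
    exact mul_pos (by linarith [hx.1]) (by linarith [hx.1])

theorem interlacing_disjoint (hsep : ∀ k l, k < l → q l < p k)
    {k l : Idx n} {x : ℝ} (hk : x ∈ Set.Icc (p k) (q k))
    (hl : x ∈ Set.Icc (p l) (q l)) : k = l := by
  by_contra hne
  rcases lt_or_gt_of_ne hne with h | h
  · linarith [hsep k l h, hk.1, hl.2]
  · linarith [hsep l k h, hl.1, hk.2]

theorem strictAnti_of_mem (hsep : ∀ k l, k < l → q l < p k)
    {y : Idx n → ℝ} (hy : ∀ l, y l ∈ Set.Icc (p l) (q l)) :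
    StrictAnti y := fun k l h => by linarith [hsep k l h, (hy k).1, (hy l).2]

/-- The pencil spanned by two polynomials with interlacing zeros. -/
theorem exists_pencil_roots (hpq : ∀ l, p l < q l) (hsep : ∀ k l, k < l → q l < p k)
    {τ : ℝ} (hτ : τ ∈ Set.Ioo (0 : ℝ) 1) :
    ∃ y : Idx n → ℝ, (∀ l, y l ∈ Set.Ioo (p l) (q l)) ∧
      C (1 - τ) * Lagrange.nodal Finset.univ p + C τ * Lagrange.nodal Finset.univ q =
        Lagrange.nodal Finset.univ y := by
  set R : ℝ[X] := C (1 - τ) * Lagrange.nodal Finset.univ p + C τ * Lagrange.nodal Finset.univ q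
    with hR
  have heval : ∀ x, R.eval x = (1 - τ) * ∏ k, (x - p k) + τ * ∏ k, (x - q k) := fun x => by
    simp [hR, Lagrange.eval_nodal]
  -- At `p l` only the `τ` term survives and at `q l` only the `1 - τ` term, with opposite signs.
  have hroot : ∀ l, ∃ x ∈ Set.Ioo (p l) (q l), R.eval x = 0 := by
    intro l
    have h1 : 0 < (-1) ^ (l : ℕ) * R.eval (p l) := by
      have := prod_upper_sign hpq hsep (l := l) ⟨le_rfl, hpq l⟩
      rw [heval, Finset.prod_eq_zero (Finset.mem_univ l) (sub_self (p l)), mul_zero, zero_add,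
        mul_left_comm]
      exact mul_pos hτ.1 this
    have h2 : (-1) ^ (l : ℕ) * R.eval (q l) < 0 := by
      have := prod_lower_sign hpq hsep (l := l) ⟨hpq l, le_rfl⟩
      rw [heval, Finset.prod_eq_zero (f := fun k => q l - q k) (Finset.mem_univ l)
        (sub_self (q l)), mul_zero, add_zero,
        mul_left_comm]
      exact mul_neg_of_pos_of_neg (by linarith [hτ.2]) this
    have hc : ContinuousOn (fun x => (-1) ^ (l : ℕ) * R.eval x) (Set.Icc (p l) (q l)) :=
      (continuous_const.mul R.continuous).continuousOn
    obtain ⟨x, hx, hx0⟩ := intermediate_value_Ioo' (hpq l).le hc ⟨h2, h1⟩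
    exact ⟨x, hx, (mul_eq_zero.1 hx0).resolve_left (by simp)⟩
  choose y hy hy0 using hroot
  refine ⟨y, hy, ?_⟩
  have hanti := strictAnti_of_mem hsep fun l => Set.Ioo_subset_Icc_self (hy l)
  -- Both sides are monic of degree `n`, so their difference has degree below `n` and is killed by
  -- the `n` distinct zeros `y l`.
  refine Polynomial.eq_of_degree_sub_lt_of_eval_index_eq (s := Finset.univ)
    hanti.injective.injOn ?_ fun l _ => by
      rw [hy0, Lagrange.eval_nodal_at_node (Finset.mem_univ l)]
  have hcoeff : ∀ c : Idx n → ℝ, (Lagrange.nodal Finset.univ c).coeff n = 1 := fun c => by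
    have := (Lagrange.nodal_monic (s := Finset.univ) (v := c)).coeff_natDegree
    rwa [Lagrange.natDegree_nodal, Idx.card_univ] at this
  have hle : ∀ c : Idx n → ℝ, (Lagrange.nodal Finset.univ c).degree ≤ (n : ℕ) := fun c => by
    rw [Lagrange.degree_nodal, Idx.card_univ]
  rw [Idx.card_univ, degree_lt_iff_coeff_zero]
  intro m hm
  rcases hm.eq_or_lt with rfl | hm
  · rw [hR, coeff_sub, coeff_add, coeff_C_mul, coeff_C_mul, hcoeff, hcoeff, hcoeff]; ring
  · have h0 : ∀ c : Idx n → ℝ, (Lagrange.nodal Finset.univ c).coeff m = 0 := fun c =>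
      coeff_eq_zero_of_degree_lt ((hle c).trans_lt (by exact_mod_cast hm))
    rw [hR, coeff_sub, coeff_add, coeff_C_mul, coeff_C_mul, h0, h0, h0]; ring

end Interlacing

/-! ### Period relations between the intervals -/

section Period

open Polynomial MeasureTheory

variable {n : ℕ} {p q : Idx n → ℝ}

/-- The parameter of the member of the pencil which vanishes at `x`. -/
noncomputable def pencilParam (p q : Idx n → ℝ) (x : ℝ) : ℝ :=
  (∏ k, (x - p k)) / (∏ k, (x - p k) - ∏ k, (x - q k))

theorem pencil_signs (hpq : ∀ l, p l < q l) (hsep : ∀ k l, k < l → q l < p k) {l : Idx n} {x : ℝ}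
    (hx : x ∈ Set.Ioo (p l) (q l)) :
    (∏ k, (x - p k)) * ∏ k, (x - q k) < 0 := by
  have h1 := prod_lower_sign hpq hsep (l := l) ⟨hx.1, hx.2.le⟩
  have h2 := prod_upper_sign hpq hsep (l := l) ⟨hx.1.le, hx.2⟩
  have h3 : (-1 : ℝ) ^ (l : ℕ) * (-1) ^ (l : ℕ) = 1 := by rw [← mul_pow]; simp
  have h4 := mul_neg_of_neg_of_pos h1 h2
  calc (∏ k, (x - p k)) * ∏ k, (x - q k)
      = ((-1 : ℝ) ^ (l : ℕ) * (-1) ^ (l : ℕ)) * ((∏ k, (x - p k)) * ∏ k, (x - q k)) := by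
        rw [h3, one_mul]
    _ < 0 := by linarith

theorem pencilParam_mem {u v : ℝ} (h : u * v < 0) : u / (u - v) ∈ Set.Ioo (0 : ℝ) 1 := by
  rcases mul_neg_iff.1 h with ⟨hu, hv⟩ | ⟨hu, hv⟩
  · have : 0 < u - v := by linarith
    exact ⟨by positivity, by rw [div_lt_one this]; linarith⟩
  · have : u - v < 0 := by linarith
    exact ⟨div_pos_of_neg_of_neg hu this, by rw [div_lt_one_of_neg this]; linarith⟩

/-- The root equation is linear in `τ`, and its coefficient is nonzero because the two products have
opposite signs. Thus `pencilParam` inverts each root branch of the pencil. -/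
theorem pencilParam_eq_of_root (hpq : ∀ l, p l < q l) (hsep : ∀ k l, k < l → q l < p k)
    {l : Idx n} {x : ℝ} (hx : x ∈ Set.Ioo (p l) (q l)) (τ : ℝ) :
    (1 - τ) * ∏ k, (x - p k) + τ * ∏ k, (x - q k) = 0 ↔ pencilParam p q x = τ := by
  have h := pencil_signs hpq hsep hx
  have hne : ∏ k, (x - p k) - ∏ k, (x - q k) ≠ 0 := by
    intro h0
    rw [sub_eq_zero.1 h0] at h
    nlinarith
  rw [pencilParam, div_eq_iff hne]
  constructor <;> intro h <;> linarith

/-- The change of variables `x ↦ pencilParam p q x` on the interval `(p l, q l)`. -/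
theorem exists_pencil_substitution (hpq : ∀ l, p l < q l) (hsep : ∀ k l, k < l → q l < p k) :
    ∃ y : ℝ → Idx n → ℝ, (∀ τ ∈ Set.Ioo (0 : ℝ) 1, ∀ l, y τ l ∈ Set.Ioo (p l) (q l)) ∧
      ∀ (l : Idx n) (B : ℝ → ℝ),
        (IntegrableOn (fun x => B x / √(-((∏ k, (x - p k)) * ∏ k, (x - q k))))
            (Set.Ioo (p l) (q l)) →
          IntegrableOn (fun τ => B (y τ l) / |∏ k ∈ Finset.univ.erase l, (y τ l - y τ k)| /
            √(τ * (1 - τ))) (Set.Ioo 0 1)) ∧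
        ∫ x in Set.Ioo (p l) (q l), B x / √(-((∏ k, (x - p k)) * ∏ k, (x - q k))) =
          ∫ τ in Set.Ioo (0 : ℝ) 1, B (y τ l) / |∏ k ∈ Finset.univ.erase l, (y τ l - y τ k)| /
            √(τ * (1 - τ)) := by
  have hex : ∀ τ : ℝ, ∃ y : Idx n → ℝ, τ ∈ Set.Ioo (0 : ℝ) 1 → (∀ l, y l ∈ Set.Ioo (p l) (q l)) ∧
      C (1 - τ) * Lagrange.nodal Finset.univ p + C τ * Lagrange.nodal Finset.univ q =
        Lagrange.nodal Finset.univ y := by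
    intro τ
    by_cases hτ : τ ∈ Set.Ioo (0 : ℝ) 1
    · obtain ⟨y, hy⟩ := exists_pencil_roots hpq hsep hτ
      exact ⟨y, fun _ => hy⟩
    -- Outside `(0, 1)` the value is arbitrary.
    · exact ⟨0, fun h => absurd h hτ⟩
  choose y hy using hex
  refine ⟨y, fun τ hτ => (hy τ hτ).1, fun l B => ?_⟩
  have hmem : ∀ x ∈ Set.Ioo (p l) (q l), pencilParam p q x ∈ Set.Ioo (0 : ℝ) 1 := fun x hx =>
    pencilParam_mem (pencil_signs hpq hsep hx)
  have hinv : ∀ x ∈ Set.Ioo (p l) (q l), y (pencilParam p q x) l = x := by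
    intro x hx
    obtain ⟨h1, h2⟩ := hy _ (hmem x hx)
    have h3 := (pencilParam_eq_of_root hpq hsep hx _).2 rfl
    have h4 := congrArg (eval x) h2
    simp only [eval_add, eval_mul, eval_C, Lagrange.eval_nodal] at h4
    rw [h3] at h4
    obtain ⟨k, -, hk⟩ := Finset.prod_eq_zero_iff.1 h4.symm
    have hk' : x = y (pencilParam p q x) k := sub_eq_zero.1 hk
    have : k = l := interlacing_disjoint hsep (x := x)
      (hk' ▸ Set.Ioo_subset_Icc_self (h1 k)) (Set.Ioo_subset_Icc_self hx)
    rw [← this]; exact hk'.symm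
  have himage : pencilParam p q '' Set.Ioo (p l) (q l) = Set.Ioo 0 1 := by
    refine Set.Subset.antisymm (Set.image_subset_iff.2 hmem) fun τ hτ => ?_
    obtain ⟨h1, h2⟩ := hy τ hτ
    refine ⟨y τ l, h1 l, (pencilParam_eq_of_root hpq hsep (h1 l) τ).1 ?_⟩
    have h4 := congrArg (eval (y τ l)) h2
    simpa [Lagrange.eval_nodal_at_node, Lagrange.eval_nodal] using h4
  have hinj : Set.InjOn (pencilParam p q) (Set.Ioo (p l) (q l)) := fun x hx x' hx' h => by
    rw [← hinv x hx, h, hinv x' hx']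
  -- With `P`, `Q` the two products, the quotient rule gives `(P Q' - P' Q) / (P - Q)²`. At the
  -- root, `(P Q' - P' Q) / (P - Q)` is the derivative of the pencil member, i.e. the product over
  -- the other roots.
  set f' : ℝ → ℝ := fun x => (∏ k ∈ Finset.univ.erase l, (x - y (pencilParam p q x) k)) /
    (∏ k, (x - p k) - ∏ k, (x - q k)) with hf'
  have hderiv : ∀ x ∈ Set.Ioo (p l) (q l),
      HasDerivWithinAt (pencilParam p q) (f' x) (Set.Ioo (p l) (q l)) x := by
    intro x hx
    have hlt := pencil_signs hpq hsep hx
    have hne : ∏ k, (x - p k) - ∏ k, (x - q k) ≠ 0 := by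
      intro h0
      rw [sub_eq_zero.1 h0] at hlt
      nlinarith
    have hn : ∀ c : Idx n → ℝ, HasDerivAt (fun x => ∏ k, (x - c k))
        ((derivative (Lagrange.nodal Finset.univ c)).eval x) x := fun c => by
      simpa [Lagrange.eval_nodal] using (Lagrange.nodal Finset.univ c).hasDerivAt x
    have hd := (hn p).fun_div ((hn p).fun_sub (hn q)) hne
    obtain ⟨h1, h2⟩ := hy _ (hmem x hx)
    have h3 := congrArg (fun R => (derivative R).eval x) h2
    have h5 := Lagrange.eval_nodal_derivative_eval_node_eq
      (v := y (pencilParam p q x)) (Finset.mem_univ l)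
    rw [hinv x hx, Lagrange.eval_nodal] at h5
    simp only [derivative_add, derivative_C_mul, eval_add, eval_mul, eval_C] at h3
    rw [h5] at h3
    refine (hd.congr_deriv ?_).hasDerivWithinAt
    rw [hf']
    dsimp only
    rw [← h3, pencilParam]
    field_simp
    ring
  have hpt : ∀ x ∈ Set.Ioo (p l) (q l),
      |f' x| • (B (y (pencilParam p q x) l) / |∏ k ∈ Finset.univ.erase l,
        (y (pencilParam p q x) l - y (pencilParam p q x) k)| /
          √(pencilParam p q x * (1 - pencilParam p q x))) =
      B x / √(-((∏ k, (x - p k)) * ∏ k, (x - q k))) := by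
    intro x hx
    have hlt := pencil_signs hpq hsep hx
    have hne : ∏ k, (x - p k) - ∏ k, (x - q k) ≠ 0 := by
      intro h0
      rw [sub_eq_zero.1 h0] at hlt
      nlinarith
    have hD : ∏ k ∈ Finset.univ.erase l, (x - y (pencilParam p q x) k) ≠ 0 := by
      refine Finset.prod_ne_zero_iff.2 fun k hk h0 => Finset.ne_of_mem_erase hk ?_
      refine interlacing_disjoint hsep (x := x) ?_ (Set.Ioo_subset_Icc_self hx)
      rw [sub_eq_zero.1 h0]
      exact Set.Ioo_subset_Icc_self ((hy _ (hmem x hx)).1 k)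
    -- Since `τ (1 - τ) = -P Q / (P - Q)²`, the denominator of the Jacobian cancels.
    have hsq : √(pencilParam p q x * (1 - pencilParam p q x)) =
        √(-((∏ k, (x - p k)) * ∏ k, (x - q k))) / |∏ k, (x - p k) - ∏ k, (x - q k)| := by
      rw [← Real.sqrt_sq_eq_abs, ← Real.sqrt_div (by linarith), pencilParam]
      congr 1
      field_simp
      ring
    rw [hinv x hx, hsq, hf', smul_eq_mul, abs_div]
    have hs : √(-((∏ k, (x - p k)) * ∏ k, (x - q k))) ≠ 0 := (Real.sqrt_pos.2 (by linarith)).ne'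
    have ha := abs_ne_zero.2 hne
    have hb := abs_ne_zero.2 hD
    field_simp
  constructor
  · intro hint
    rw [← himage, integrableOn_image_iff_integrableOn_abs_deriv_smul measurableSet_Ioo hderiv hinj]
    exact hint.congr_fun (fun x hx => (hpt x hx).symm) measurableSet_Ioo
  · rw [← himage, integral_image_eq_integral_abs_deriv_smul measurableSet_Ioo hderiv hinj]
    exact (setIntegral_congr_fun measurableSet_Ioo hpt).symm

/-- The trigonometric parametrization of an interval. -/
theorem integral_trig_substitution {a b : ℝ} (hab : a < b) (w : ℝ → ℝ) :
    (IntegrableOn (fun θ => (b - a) / 2 * Real.sin θ *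
        w ((a + b) / 2 + (b - a) / 2 * Real.cos θ)) (Set.Ioo 0 Real.pi) →
      IntegrableOn w (Set.Ioo a b)) ∧
    ∫ x in Set.Ioo a b, w x = ∫ θ in Set.Ioo 0 Real.pi,
      (b - a) / 2 * Real.sin θ * w ((a + b) / 2 + (b - a) / 2 * Real.cos θ) := by
  have hr : 0 < (b - a) / 2 := by linarith
  set f : ℝ → ℝ := fun θ => (a + b) / 2 + (b - a) / 2 * Real.cos θ with hf
  have hd : ∀ θ ∈ Set.Ioo 0 Real.pi,
      HasDerivWithinAt f ((b - a) / 2 * (-Real.sin θ)) (Set.Ioo 0 Real.pi) θ := fun θ _ =>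
    (((Real.hasDerivAt_cos θ).const_mul _).const_add _).hasDerivWithinAt
  have hinj : Set.InjOn f (Set.Ioo 0 Real.pi) := by
    intro θ hθ θ' hθ' h
    have h1 : Real.cos θ = Real.cos θ' := mul_left_cancel₀ hr.ne' (add_left_cancel h)
    exact Real.injOn_cos (Set.Ioo_subset_Icc_self hθ) (Set.Ioo_subset_Icc_self hθ') h1
  have himage : f '' Set.Ioo 0 Real.pi = Set.Ioo a b := by
    ext x
    constructor
    · rintro ⟨θ, hθ, rfl⟩
      have h1 : Real.cos θ < 1 := by
        have := Real.cos_lt_cos_of_nonneg_of_le_pi le_rfl hθ.2.le hθ.1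
        rwa [Real.cos_zero] at this
      have h2 : -1 < Real.cos θ := by
        have := Real.cos_lt_cos_of_nonneg_of_le_pi hθ.1.le le_rfl hθ.2
        rwa [Real.cos_pi] at this
      constructor <;> simp only [hf] <;> nlinarith
    · intro hx
      set c := (x - (a + b) / 2) / ((b - a) / 2) with hc
      have h1 : -1 < c := by rw [hc, lt_div_iff₀ hr]; linarith [hx.1]
      have h2 : c < 1 := by rw [hc, div_lt_one hr]; linarith [hx.2]
      refine ⟨Real.arccos c, ⟨Real.arccos_pos.2 h2, ?_⟩, ?_⟩
      · refine lt_of_le_of_ne (Real.arccos_le_pi c) fun h => ?_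
        rw [Real.arccos_eq_pi] at h
        linarith
      · simp only [hf]
        rw [Real.cos_arccos h1.le h2.le, hc, mul_div_cancel₀ _ hr.ne']
        ring
  have hpt : ∀ θ ∈ Set.Ioo 0 Real.pi, |(b - a) / 2 * (-Real.sin θ)| • w (f θ) =
      (b - a) / 2 * Real.sin θ * w ((a + b) / 2 + (b - a) / 2 * Real.cos θ) := fun θ hθ => by
    rw [abs_mul, abs_neg, abs_of_pos hr, abs_of_pos (Real.sin_pos_of_mem_Ioo hθ), smul_eq_mul]
  constructor
  · intro h
    rw [← himage, integrableOn_image_iff_integrableOn_abs_deriv_smul measurableSet_Ioo hd hinj]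
    exact h.congr_fun (fun θ hθ => (hpt θ hθ).symm) measurableSet_Ioo
  · rw [← himage, integral_image_eq_integral_abs_deriv_smul measurableSet_Ioo hd hinj]
    exact setIntegral_congr_fun measurableSet_Ioo hpt

/-- The parametrization of `[p l, q l]` by an angle. -/
noncomputable def angleParam (p q : Idx n → ℝ) (l : Idx n) (θ : ℝ) : ℝ :=
  (p l + q l) / 2 + (q l - p l) / 2 * Real.cos θ

/-- The product over the other intervals. -/
noncomputable def gapFactor (p q : Idx n → ℝ) (l : Idx n) (x : ℝ) : ℝ :=
  ∏ k ∈ Finset.univ.erase l, (x - p k) * (x - q k)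

theorem angleParam_mem (hpq : ∀ l, p l < q l) (l : Idx n) (θ : ℝ) :
    angleParam p q l θ ∈ Set.Icc (p l) (q l) := by
  have h1 := Real.neg_one_le_cos θ
  have h2 := Real.cos_le_one θ
  have h3 := hpq l
  constructor <;> simp only [angleParam] <;> nlinarith

theorem angleParam_mem_Ioo (hpq : ∀ l, p l < q l) (l : Idx n) {θ : ℝ} (hθ : θ ∈ Set.Ioo 0 Real.pi) :
    angleParam p q l θ ∈ Set.Ioo (p l) (q l) := by
  have h1 : Real.cos θ < 1 := by
    have := Real.cos_lt_cos_of_nonneg_of_le_pi le_rfl hθ.2.le hθ.1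
    rwa [Real.cos_zero] at this
  have h2 : -1 < Real.cos θ := by
    have := Real.cos_lt_cos_of_nonneg_of_le_pi hθ.1.le le_rfl hθ.2
    rwa [Real.cos_pi] at this
  have h3 := hpq l
  constructor <;> simp only [angleParam] <;> nlinarith

theorem continuous_angleParam (l : Idx n) : Continuous (angleParam p q l) := by
  unfold angleParam; fun_prop

theorem continuous_gapFactor (l : Idx n) : Continuous (gapFactor p q l) := by
  unfold gapFactor; fun_prop

theorem gapFactor_pos (hpq : ∀ l, p l < q l) (hsep : ∀ k l, k < l → q l < p k) (l : Idx n) (θ : ℝ) :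
    0 < gapFactor p q l (angleParam p q l θ) :=
  gap_factor_pos hpq hsep l (angleParam_mem hpq l θ)

theorem continuous_comp_angleParam (hpq : ∀ l, p l < q l) (hsep : ∀ k l, k < l → q l < p k)
    (l : Idx n) {w : ℝ → ℝ} (hw : ContinuousOn w (Set.Icc (p l) (q l))) :
    Continuous fun θ => w (angleParam p q l θ) / √(gapFactor p q l (angleParam p q l θ)) := by
  refine Continuous.div (hw.comp_continuous (continuous_angleParam l) (angleParam_mem hpq l))
    (Real.continuous_sqrt.comp ((continuous_gapFactor l).comp (continuous_angleParam l)))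
    fun θ => (Real.sqrt_pos.2 (gapFactor_pos hpq hsep l θ)).ne'

/-- The alternating sum of the integrals of a polynomial of low degree over the intervals
vanishes. -/
theorem sum_period_eq_zero (hpq : ∀ l, p l < q l) (hsep : ∀ k l, k < l → q l < p k) {B : ℝ[X]}
    (hB : B.degree < (n - 1 : ℕ)) :
    ∑ l : Idx n, (-1) ^ (l : ℕ) * ∫ θ in (0 : ℝ)..Real.pi,
      B.eval (angleParam p q l θ) / √(gapFactor p q l (angleParam p q l θ)) = 0 := by
  obtain ⟨y, hy, hsub⟩ := exists_pencil_substitution hpq hsep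
  set w : ℝ → ℝ := fun x => B.eval x / √(-((∏ k, (x - p k)) * ∏ k, (x - q k))) with hw
  have hpt : ∀ l, ∀ θ ∈ Set.Ioo 0 Real.pi,
      B.eval (angleParam p q l θ) / √(gapFactor p q l (angleParam p q l θ)) =
      (q l - p l) / 2 * Real.sin θ * w ((p l + q l) / 2 + (q l - p l) / 2 * Real.cos θ) := by
    intro l θ hθ
    have hsin := Real.sin_pos_of_mem_Ioo hθ
    have hr : 0 < (q l - p l) / 2 := by linarith [hpq l]
    have hQ := gapFactor_pos hpq hsep l θ
    -- The factors of index `l` give `-(x - p l) (x - q l) = ((q l - p l) / 2 * sin θ)²`, which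
    -- cancels the Jacobian and leaves an integrand regular at both ends.
    have hP : -((∏ k, (angleParam p q l θ - p k)) * ∏ k, (angleParam p q l θ - q k)) =
        ((q l - p l) / 2 * Real.sin θ) ^ 2 * gapFactor p q l (angleParam p q l θ) := by
      rw [← Finset.prod_mul_distrib, ← Finset.mul_prod_erase _ _ (Finset.mem_univ l), gapFactor,
        ← neg_mul]
      congr 1
      have := Real.sin_sq_add_cos_sq θ
      simp only [angleParam]
      linear_combination (-(q l - p l) ^ 2 / 4) * this
    change _ = (q l - p l) / 2 * Real.sin θ * w (angleParam p q l θ)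
    rw [hw]
    dsimp only
    rw [hP, Real.sqrt_mul (sq_nonneg _), Real.sqrt_sq (by positivity)]
    have := (Real.sqrt_pos.2 hQ).ne'
    have : q l - p l ≠ 0 := by linarith
    field_simp
  have hint : ∀ l, IntegrableOn w (Set.Ioo (p l) (q l)) := by
    intro l
    refine (integral_trig_substitution (hpq l) w).1 ?_
    refine IntegrableOn.congr_fun ?_ (hpt l) measurableSet_Ioo
    exact ((continuous_comp_angleParam hpq hsep l B.continuous.continuousOn).integrableOn_Icc
      (a := 0) (b := Real.pi)).mono_set Set.Ioo_subset_Icc_self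
  have heq : ∀ l, ∫ θ in (0 : ℝ)..Real.pi,
      B.eval (angleParam p q l θ) / √(gapFactor p q l (angleParam p q l θ)) =
      ∫ τ in Set.Ioo (0 : ℝ) 1, B.eval (y τ l) / |∏ k ∈ Finset.univ.erase l, (y τ l - y τ k)| /
        √(τ * (1 - τ)) := by
    intro l
    rw [intervalIntegral.integral_of_le Real.pi_pos.le, integral_Ioc_eq_integral_Ioo,
      setIntegral_congr_fun measurableSet_Ioo (hpt l), ← (integral_trig_substitution (hpq l) w).2]
    exact (hsub l fun x => B.eval x).2
  simp_rw [heq, ← integral_const_mul]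
  rw [← integral_finsetSum _ fun l _ =>
    ((hsub l fun x => B.eval x).1 (hint l)).integrable.const_mul _]
  -- All intervals now share the variable `τ`, and the alternating sum vanishes for each `τ` by
  -- partial fractions.
  refine setIntegral_eq_zero_of_forall_eq_zero fun τ hτ => ?_
  have hanti := strictAnti_of_mem hsep fun l => Set.Ioo_subset_Icc_self (hy τ hτ l)
  have := sum_eval_div_abs_eq_zero hanti hB
  rw [Finset.sum_congr rfl fun l _ => (mul_div_assoc _ _ _).symm, ← Finset.sum_div, this, zero_div]

end Period

/-! ### The monotonicity condition and the order of the phases -/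

section Sign

open Polynomial MeasureTheory

variable {n : ℕ} {p q : Idx n → ℝ}

namespace LiouvilleData

theorem a_strictAntiOn (D : LiouvilleData n) {i j : ℕ} (hij : i < j) (hj : j ≤ n) :
    D.a j < D.a i := by
  induction j, hij using Nat.le_induction with
  | base => exact D.a_lt i hj
  | succ k hk ih => exact (D.a_lt k hj).trans (ih (by omega))

theorem a_antitone (D : LiouvilleData n) {i j : ℕ} (hij : i ≤ j) (hj : j ≤ n) :
    D.a j ≤ D.a i := by
  rcases hij.eq_or_lt with rfl | h
  · exact le_rfl
  · exact (D.a_strictAntiOn h hj).le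

theorem a_mem (D : LiouvilleData n) {k : ℕ} (hk : k ≤ n) : D.a k ∈ Set.Icc (D.a n) (D.a 0) :=
  ⟨D.a_antitone hk le_rfl, D.a_antitone (Nat.zero_le k) hk⟩

theorem a_injOn (D : LiouvilleData n) : Set.InjOn D.a (Finset.Icc 1 n : Finset ℕ) := by
  intro i hi j hj h
  have hi := Finset.mem_Icc.1 hi
  have hj := Finset.mem_Icc.1 hj
  rcases lt_trichotomy i j with h' | h' | h'
  · exact absurd h (D.a_strictAntiOn h' hj.2).ne'
  · exact h'
  · exact absurd h (D.a_strictAntiOn h' hi.2).ne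

theorem Icc_subset (D : LiouvilleData n) (hp : ∀ l : Idx n, D.a l ≤ p l)
    (hq : ∀ l : Idx n, q l ≤ D.a (l - 1)) (l : Idx n) :
    Set.Icc (p l) (q l) ⊆ Set.Icc (D.a n) (D.a 0) := by
  have hl := Finset.mem_Icc.1 l.2
  exact Set.Icc_subset_Icc ((D.a_mem hl.2).1.trans (hp l))
    ((hq l).trans (D.a_mem (k := (l : ℕ) - 1) (by omega)).2)

theorem continuousOn_weight (D : LiouvilleData n) (hp : ∀ l : Idx n, D.a l ≤ p l)
    (hq : ∀ l : Idx n, q l ≤ D.a (l - 1)) (l : Idx n) (G : ℝ[X]) :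
    ContinuousOn (fun x => G.eval x * D.A x) (Set.Icc (p l) (q l)) :=
  G.continuous.continuousOn.mul (D.A_smooth.continuousOn.mono (D.Icc_subset hp hq l))

theorem prod_nodes_sign (D : LiouvilleData n) {l : Idx n} {x : ℝ} (h₁ : D.a l < x)
    (h₂ : x < D.a (l - 1)) : (-1) ^ (l : ℕ) * ∏ k ∈ Finset.Icc 1 n, (x - D.a k) < 0 := by
  have hl := Finset.mem_Icc.1 l.2
  have := prod_sub_sign (s := Finset.Icc 1 n) (x := x) (c := D.a) (l := (l : ℕ))
    (fun k hk h => h₂.trans_le (D.a_antitone (by omega) (by omega)))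
    (fun k hk h => (D.a_antitone h (Finset.mem_Icc.1 hk).2).trans_lt h₁)
  rw [card_filter_Icc_lt hl.1 (by omega)] at this
  exact neg_one_pow_mul_pos_of_sub_one hl.1 this

/-- The comparison of `A` with polynomials: the sign of the interpolation remainder. -/
theorem exists_low_degree_comparison (D : LiouvilleData n) (hD : D.MonotonicityCondition)
    {N : Finset ℕ} (hN : N ⊆ Finset.Icc 1 n) (hM : 2 ≤ N.card) :
    ∃ B : ℝ[X], B.degree < (n - 1 : ℕ) ∧ ∀ (l : Idx n) (x : ℝ), D.a l < x → x < D.a (l - 1) →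
      (-1) ^ N.card * ((-1) ^ (l : ℕ) *
        ((Lagrange.nodal (Finset.Icc 1 n \ N) D.a).eval x * D.A x - B.eval x)) < 0 := by
  have hcard : N.card ≤ n := by simpa using Finset.card_le_card hN
  have hn0 : D.a n < D.a 0 := D.a_strictAntiOn (by omega) le_rfl
  set F : ℝ → ℝ := fun s => (s - D.a n) * D.A s with hF
  set P := Lagrange.interpolate N D.a (fun k => F (D.a k)) with hP
  set G := Lagrange.nodal (Finset.Icc 1 n \ N) D.a with hG
  have hinj : Set.InjOn D.a N := D.a_injOn.mono (by exact_mod_cast hN)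
  -- The division by `X - a n` undoes the factor in `Ã` and lowers the degree to at most `n - 2`. It
  -- is possible because `P` inherits the zero of `Ã` if `n ∈ N`, while otherwise `G` vanishes at `a
  -- n`.
  have hroot : (G * P).IsRoot (D.a n) := by
    rw [IsRoot, eval_mul]
    by_cases h : n ∈ N
    · rw [hP, Lagrange.eval_interpolate_at_node _ hinj h, hF]; simp
    · rw [hG, Lagrange.eval_nodal_at_node (by simp [h]; omega), zero_mul]
  obtain ⟨B, hB⟩ := dvd_iff_isRoot.2 hroot
  refine ⟨B, ?_, ?_⟩
  · by_cases hB0 : B = 0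
    · rw [hB0, degree_zero]; exact WithBot.bot_lt_coe _
    have hP0 : P ≠ 0 := by
      rintro h0
      rw [h0, mul_zero] at hB
      exact (mul_ne_zero (X_sub_C_ne_zero _) hB0) hB.symm
    have h1 : P.natDegree < N.card := by
      rw [natDegree_lt_iff_degree_lt hP0]; exact Lagrange.degree_interpolate_lt _ hinj
    have h2 : (G * P).natDegree = (n - N.card) + P.natDegree := by
      rw [natDegree_mul (Lagrange.nodal_ne_zero) hP0, Lagrange.natDegree_nodal,
        Finset.card_sdiff_of_subset hN, Nat.card_Icc, Nat.add_sub_cancel]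
    have h3 : (G * P).natDegree = 1 + B.natDegree := by
      rw [hB, natDegree_mul (X_sub_C_ne_zero _) hB0, natDegree_X_sub_C]
    rw [← natDegree_lt_iff_degree_lt hB0]
    omega
  · intro l x h₁ h₂
    have hl := Finset.mem_Icc.1 l.2
    have hx : x ∈ Set.Icc (D.a n) (D.a 0) :=
      ⟨(D.a_mem hl.2).1.trans h₁.le, h₂.le.trans (D.a_mem (k := (l : ℕ) - 1) (by omega)).2⟩
    have hxn : 0 < x - D.a n := by linarith [(D.a_mem hl.2).1]
    have hFs : ContDiffOn ℝ N.card F (Set.Icc (D.a n) (D.a 0)) :=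
      (contDiff_id.sub contDiff_const).contDiffOn.mul (D.A_smooth.of_le (by exact_mod_cast le_top))
    obtain ⟨z, hz, hz'⟩ := exists_eq_interpolate_add hn0 hFs hinj
      (fun k hk => D.a_mem (Finset.mem_Icc.1 (hN hk)).2) hx
    have hmono := hD N.card hM hcard z hz
    have hev := congrArg (eval x) hB
    simp only [eval_mul, eval_sub, eval_X, eval_C] at hev
    have hprod : G.eval x * ∏ k ∈ N, (x - D.a k) = ∏ k ∈ Finset.Icc 1 n, (x - D.a k) := by
      rw [hG, Lagrange.eval_nodal, Finset.prod_sdiff hN]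
    -- Multiplying the remainder by `G` completes its node product to all `k` in `1, …, n`, so its
    -- sign on the `l`-th interval no longer depends on `N`.
    have key : (x - D.a n) * (G.eval x * D.A x - B.eval x) =
        iteratedDerivWithin N.card F (Set.Icc (D.a n) (D.a 0)) z / N.card.factorial *
          ∏ k ∈ Finset.Icc 1 n, (x - D.a k) := by
      have e1 : (x - D.a n) * D.A x = P.eval x +
        iteratedDerivWithin N.card F (Set.Icc (D.a n) (D.a 0)) z / N.card.factorial *
          ∏ k ∈ N, (x - D.a k) := hz'
      rw [← hprod]
      linear_combination G.eval x * e1 + hev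
    have hs := D.prod_nodes_sign h₁ h₂
    have hf : (0 : ℝ) < N.card.factorial := by positivity
    have h5 : (x - D.a n) * ((-1) ^ N.card * ((-1) ^ (l : ℕ) * (G.eval x * D.A x - B.eval x))) =
        ((-1) ^ N.card * iteratedDerivWithin N.card F (Set.Icc (D.a n) (D.a 0)) z) /
          N.card.factorial * ((-1) ^ (l : ℕ) * ∏ k ∈ Finset.Icc 1 n, (x - D.a k)) := by
      linear_combination (-1) ^ N.card * (-1) ^ (l : ℕ) * key
    have h6 := mul_neg_of_pos_of_neg (div_pos hmono hf) hs
    rw [← h5] at h6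
    exact neg_of_mul_neg_right h6 hxn.le

/-- The sign of the alternating sum of the periods of `G A`, where the zeros of the polynomial `G`
are the nodes `a k` with `k ∉ N`. -/
theorem sum_weighted_period_sign (D : LiouvilleData n) (hD : D.MonotonicityCondition)
    (hpq : ∀ l, p l < q l) (hsep : ∀ k l, k < l → q l < p k)
    (hp : ∀ l : Idx n, D.a l ≤ p l) (hq : ∀ l : Idx n, q l ≤ D.a (l - 1))
    {N : Finset ℕ} (hN : N ⊆ Finset.Icc 1 n) (hM : 2 ≤ N.card) :
    (-1) ^ N.card * ∑ l : Idx n, (-1) ^ (l : ℕ) * ∫ θ in (0 : ℝ)..Real.pi,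
      (Lagrange.nodal (Finset.Icc 1 n \ N) D.a).eval (angleParam p q l θ) *
        D.A (angleParam p q l θ) / √(gapFactor p q l (angleParam p q l θ)) < 0 := by
  obtain ⟨B, hB, hsign⟩ := D.exists_low_degree_comparison hD hN hM
  have hcard : N.card ≤ n := by simpa using Finset.card_le_card hN
  set G := Lagrange.nodal (Finset.Icc 1 n \ N) D.a with hG
  have hcG : ∀ l, Continuous fun θ => G.eval (angleParam p q l θ) *
      D.A (angleParam p q l θ) / √(gapFactor p q l (angleParam p q l θ)) := fun l =>
    continuous_comp_angleParam hpq hsep l (D.continuousOn_weight hp hq l G)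
  have hcB : ∀ l, Continuous fun θ => B.eval (angleParam p q l θ) /
      √(gapFactor p q l (angleParam p q l θ)) := fun l =>
    continuous_comp_angleParam hpq hsep l B.continuous.continuousOn
  -- `B` contributes nothing to the alternating sum, so `G A` may be replaced by `G A - B`, whose
  -- sign is known in every term.
  have h0 := sum_period_eq_zero hpq hsep hB
  have h1 : ∀ S : ℝ, S = S - ∑ l : Idx n, (-1) ^ (l : ℕ) * ∫ θ in (0 : ℝ)..Real.pi,
      B.eval (angleParam p q l θ) / √(gapFactor p q l (angleParam p q l θ)) := fun S => by
    rw [h0, sub_zero]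
  rw [h1 (∑ l : Idx n, _), ← Finset.sum_sub_distrib, Finset.mul_sum]
  have : Nonempty (Idx n) := ⟨⟨1, Finset.mem_Icc.2 ⟨le_rfl, by omega⟩⟩⟩
  refine Finset.sum_neg (fun l _ => ?_) Finset.univ_nonempty
  rw [← mul_sub, ← intervalIntegral.integral_sub ((hcG l).intervalIntegrable _ _)
    ((hcB l).intervalIntegrable _ _), ← intervalIntegral.integral_const_mul,
    ← intervalIntegral.integral_const_mul, ← neg_pos, ← intervalIntegral.integral_neg]
  refine intervalIntegral.intervalIntegral_pos_of_pos_on ?_ (fun θ hθ => ?_) Real.pi_pos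
  · exact ((((hcG l).sub (hcB l)).const_mul _).const_mul _).neg.intervalIntegrable _ _
  · have hx := angleParam_mem_Ioo hpq l hθ
    have h1 := hsign l _ ((hp l).trans_lt hx.1) (hx.2.trans_le (hq l))
    have h2 := Real.sqrt_pos.2 (gapFactor_pos hpq hsep l θ)
    have h3 := div_neg_of_neg_of_pos h1 h2
    rw [neg_pos]
    refine lt_of_eq_of_lt ?_ h3
    ring

end LiouvilleData

/-- Going down from `m + 1`, where `E` fails, the truth value flips exactly at the elements of `N`.
So the parity of the flips at or above `l` decides `E l`. -/
theorem neg_one_pow_card_filter_ge {N : Finset ℕ} {E : ℕ → Prop} [DecidablePred E] {m : ℕ}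
    (hN : ∀ k, k ∈ N ↔ k ∈ Finset.Icc 1 m ∧ ¬(E k ↔ E (k + 1))) (hE : ¬E (m + 1)) {l : ℕ}
    (hl : 1 ≤ l) (hlm : l ≤ m + 1) :
    (-1 : ℝ) ^ (N.filter (l ≤ ·)).card = if E l then -1 else 1 := by
  obtain ⟨d, hd⟩ := Nat.exists_eq_add_of_le hlm
  clear hlm
  induction d generalizing l with
  | zero =>
    obtain rfl : l = m + 1 := by omega
    have : N.filter (m + 1 ≤ ·) = ∅ := by
      refine Finset.filter_eq_empty_iff.2 fun k hk => ?_
      have := Finset.mem_Icc.1 ((hN k).1 hk).1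
      omega
    rw [this, if_neg hE]; simp
  | succ d ih =>
    have ih := ih (l := l + 1) (by omega) (by omega)
    rename' l => k
    by_cases hkN : k ∈ N
    · have : N.filter (k ≤ ·) = insert k (N.filter (k + 1 ≤ ·)) := by
        ext j
        simp only [Finset.mem_filter, Finset.mem_insert]
        constructor
        · rintro ⟨h1, h2⟩
          by_cases h : j = k
          · exact Or.inl h
          · exact Or.inr ⟨h1, by omega⟩
        · rintro (rfl | ⟨h1, h2⟩)
          · exact ⟨hkN, le_rfl⟩
          · exact ⟨h1, by omega⟩
      rw [this, Finset.card_insert_of_notMem (by simp), pow_succ, ih]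
      have := ((hN k).1 hkN).2
      by_cases h1 : E k <;> by_cases h2 : E (k + 1) <;> simp_all
    · have : N.filter (k ≤ ·) = N.filter (k + 1 ≤ ·) := by
        ext j
        simp only [Finset.mem_filter]
        constructor
        · rintro ⟨h1, h2⟩
          refine ⟨h1, ?_⟩
          have : j ≠ k := fun h => hkN (h ▸ h1)
          omega
        · rintro ⟨h1, h2⟩
          exact ⟨h1, by omega⟩
      rw [this, ih]
      have : E k ↔ E (k + 1) := by
        by_contra h
        exact hkN ((hN k).2 ⟨Finset.mem_Icc.2 ⟨hl, by omega⟩, h⟩)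
      by_cases h : E k <;> simp_all

/-- The sign of the polynomial whose zeros are the nodes at which `E` does not change. -/
theorem nodal_sign (D : LiouvilleData n) {N : Finset ℕ} {E : ℕ → Prop} [DecidablePred E]
    (hN : ∀ k, k ∈ N ↔ k ∈ Finset.Icc 1 n ∧ ¬(E k ↔ E (k + 1))) (hE : ¬E (n + 1))
    (l : Idx n) {x : ℝ} (h₁ : D.a l ≤ x) (h₂ : x ≤ D.a (l - 1)) :
    0 ≤ (if E l then 1 else -1) * ((-1) ^ N.card * ((-1) ^ (l : ℕ) *
      (Lagrange.nodal (Finset.Icc 1 n \ N) D.a).eval x)) := by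
  have hl := Finset.mem_Icc.1 l.2
  have hsub : N ⊆ Finset.Icc 1 n := fun k hk => ((hN k).1 hk).1
  have h := prod_sub_sign_le (s := Finset.Icc 1 n \ N) (x := x) (c := D.a) (l := (l : ℕ))
    (fun k hk h => h₂.trans (D.a_antitone (by omega) (by omega)))
    (fun k hk h => (D.a_antitone h (Finset.mem_Icc.1 (Finset.mem_sdiff.1 hk).1).2).trans h₁)
  have hc := neg_one_pow_card_filter_ge hN hE hl.1 (by omega)
  have e1 : ((Finset.Icc 1 n \ N).filter (· < (l : ℕ))).card + (N.filter (· < (l : ℕ))).card =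
      l - 1 := by
    rw [← card_filter_Icc_lt (n := n) hl.1 (by omega), ← Finset.card_union_of_disjoint]
    · rw [← Finset.filter_union, Finset.sdiff_union_of_subset hsub]
    · exact Finset.disjoint_filter_filter (Finset.sdiff_disjoint)
  have e2 : (N.filter (· < (l : ℕ))).card + (N.filter ((l : ℕ) ≤ ·)).card = N.card := by
    simpa only [not_lt] using Finset.card_filter_add_card_filter_not (s := N) (· < (l : ℕ))
  rw [Lagrange.eval_nodal]
  -- The `l - 1` nodes before `l` split into those outside `N`, which give the sign of `G`, and
  -- those in `N`, which number `N.card` minus the flips from `l` on. Only the latter parity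
  -- remains.
  have e3 : (-1 : ℝ) ^ N.card * (-1) ^ (l : ℕ) =
      -((-1) ^ ((Finset.Icc 1 n \ N).filter (· < (l : ℕ))).card *
        (-1) ^ (N.filter ((l : ℕ) ≤ ·)).card) := by
    set u := ((Finset.Icc 1 n \ N).filter (· < (l : ℕ))).card
    set v := (N.filter (· < (l : ℕ))).card
    set w := (N.filter ((l : ℕ) ≤ ·)).card
    have hl' : (l : ℕ) = u + v + 1 := by omega
    rw [← e2, hl', pow_add, pow_add, pow_add]
    have : (-1 : ℝ) ^ v * (-1) ^ v = 1 := by rw [← mul_pow]; simp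
    linear_combination (-(-1 : ℝ) ^ w * (-1) ^ u) * this
  rw [← mul_assoc ((-1 : ℝ) ^ N.card), e3, hc]
  split_ifs <;> linarith

/-- The angle enters through its cosine only, which is even and `2π`-periodic. -/
theorem integral_period_angle {w : ℝ → ℝ} {l : Idx n}
    (hc : Continuous fun θ => w (angleParam p q l θ)) (t : ℝ) :
    ∫ θ in t..(t + 2 * Real.pi), w (angleParam p q l θ) =
      2 * ∫ θ in (0 : ℝ)..Real.pi, w (angleParam p q l θ) := by
  have hper : Function.Periodic (fun θ => w (angleParam p q l θ)) (2 * Real.pi) := fun θ => by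
    simp [angleParam]
  rw [hper.intervalIntegral_add_eq t (-Real.pi),
    ← intervalIntegral.integral_add_adjacent_intervals (b := 0) (hc.intervalIntegrable _ _)
      (hc.intervalIntegrable _ _)]
  have h1 : ∫ θ in (-Real.pi)..0, w (angleParam p q l θ) =
      ∫ θ in (0 : ℝ)..Real.pi, w (angleParam p q l θ) := by
    have := intervalIntegral.integral_comp_neg (a := 0) (b := Real.pi)
      (fun θ => w (angleParam p q l θ))
    rw [neg_zero] at this
    rw [← this]
    simp [angleParam]
  rw [h1]
  ring_nf

/-- The phases of the coordinates cannot pass a full turn in the wrong order. -/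
theorem phase_order_contradiction (D : LiouvilleData n) (hD : D.MonotonicityCondition)
    (hpq : ∀ l, p l < q l) (hsep : ∀ k l, k < l → q l < p k)
    (hp : ∀ l : Idx n, D.a l ≤ p l) (hq : ∀ l : Idx n, q l ≤ D.a (l - 1))
    (φ₀ φ₁ : Idx n → ℝ)
    (hid : ∀ G : ℝ[X], G.degree < (n - 1 : ℕ) →
      ∑ l : Idx n, (-1) ^ (l : ℕ) * ∫ θ in (φ₀ l)..(φ₁ l),
        G.eval (angleParam p q l θ) * D.A (angleParam p q l θ) /
          √(gapFactor p q l (angleParam p q l θ)) = 0)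
    {i j : Idx n} (hij : (j : ℕ) = i + 1) (hi : φ₁ i = φ₀ i + 2 * Real.pi)
    (hj : φ₁ j ≤ φ₀ j + 2 * Real.pi) : False := by
  classical
  have hin := Finset.mem_Icc.1 i.2
  have hjn := Finset.mem_Icc.1 j.2
  -- `E` holds for the phases with at most one full turn. Phase `i` has exactly one and fits either
  -- class; excluding it forces a change between `i` and `i + 1`. The membership condition makes `E
  -- (n + 1)` false.
  set E : ℕ → Prop := fun k => k ≠ i ∧ ∃ h : k ∈ Finset.Icc 1 n,
    φ₁ ⟨k, h⟩ ≤ φ₀ ⟨k, h⟩ + 2 * Real.pi with hEdef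
  have hEn : ¬E (n + 1) := fun h => by
    obtain ⟨-, h, -⟩ := h
    have := (Finset.mem_Icc.1 h).2
    omega
  have hEi : ¬E i := fun h => h.1 rfl
  have hEj : E (i + 1) := by
    rw [← hij]
    exact ⟨by omega, j.2, hj⟩
  set N : Finset ℕ := (Finset.Icc 1 n).filter fun k => ¬(E k ↔ E (k + 1)) with hNdef
  have hN : ∀ k, k ∈ N ↔ k ∈ Finset.Icc 1 n ∧ ¬(E k ↔ E (k + 1)) := fun k => by
    simp only [hNdef, Finset.mem_filter]
  have hsub : N ⊆ Finset.Icc 1 n := Finset.filter_subset _ _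
  have hiN : (i : ℕ) ∈ N := (hN i).2 ⟨i.2, fun h => hEi (h.2 hEj)⟩
  -- `E` becomes true at `i + 1` and is false at `n + 1`, so there is a second change after `i`.
  -- This is what gives `G` degree at most `n - 2`.
  have hM : 2 ≤ N.card := by
    by_contra hlt
    have hlt : N.card ≤ 1 := by omega
    have hall : ∀ k, (i : ℕ) + 1 ≤ k → k ≤ n + 1 → E k := by
      intro k hk
      induction k, hk using Nat.le_induction with
      | base => exact fun _ => hEj
      | succ k hk ih =>
        intro hkn
        by_contra hne
        have hkN : k ∈ N := (hN k).2
          ⟨Finset.mem_Icc.2 ⟨by omega, by omega⟩, fun h => hne (h.1 (ih (by omega)))⟩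
        have := Finset.card_le_one.1 hlt _ hiN _ hkN
        omega
    exact hEn (hall (n + 1) (by omega) le_rfl)
  have hcard : N.card ≤ n := by simpa using Finset.card_le_card hsub
  set G := Lagrange.nodal (Finset.Icc 1 n \ N) D.a with hG
  have hGdeg : G.degree < (n - 1 : ℕ) := by
    rw [hG, Lagrange.degree_nodal, Finset.card_sdiff_of_subset hsub, Nat.card_Icc]
    exact_mod_cast (by omega : n + 1 - 1 - N.card < n - 1)
  set W : Idx n → ℝ → ℝ := fun l x => G.eval x * D.A x / √(gapFactor p q l x) with hW
  have hc : ∀ l, Continuous fun θ => W l (angleParam p q l θ) := fun l =>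
    continuous_comp_angleParam hpq hsep l (D.continuousOn_weight hp hq l G)
  have hS : (-1) ^ N.card * ∑ l : Idx n, (-1) ^ (l : ℕ) *
      ∫ θ in (0 : ℝ)..Real.pi, W l (angleParam p q l θ) < 0 :=
    D.sum_weighted_period_sign hD hpq hsep hp hq hsub hM
  have h0 : ∑ l : Idx n, (-1) ^ (l : ℕ) *
      ∫ θ in (φ₀ l)..(φ₁ l), W l (angleParam p q l θ) = 0 := hid G hGdeg
  have hsplit : ∀ l, ∫ θ in (φ₁ l)..(φ₀ l + 2 * Real.pi), W l (angleParam p q l θ) =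
      2 * (∫ θ in (0 : ℝ)..Real.pi, W l (angleParam p q l θ)) -
        ∫ θ in (φ₀ l)..(φ₁ l), W l (angleParam p q l θ) := fun l => by
    rw [← integral_period_angle (hc l) (φ₀ l), eq_sub_iff_add_eq']
    exact intervalIntegral.integral_add_adjacent_intervals ((hc l).intervalIntegrable _ _)
      ((hc l).intervalIntegrable _ _)
  -- By the choice of `N`, the sign of the integrand agrees with the orientation of the interval
  -- from `φ₁ l` to `φ₀ l + 2π`.
  have hpos : ∀ l : Idx n, 0 ≤ (-1) ^ N.card * ((-1) ^ (l : ℕ) *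
      ∫ θ in (φ₁ l)..(φ₀ l + 2 * Real.pi), W l (angleParam p q l θ)) := by
    intro l
    have hpt : ∀ θ, 0 ≤ (if E l then 1 else -1) * ((-1) ^ N.card * ((-1) ^ (l : ℕ) *
        W l (angleParam p q l θ))) := by
      intro θ
      have hx := angleParam_mem hpq l θ
      have h1 := nodal_sign D hN hEn l ((hp l).trans hx.1) (hx.2.trans (hq l))
      have h2 := D.A_pos _ (D.Icc_subset hp hq l hx)
      have h3 := mul_nonneg h1 (div_nonneg h2.le
        (Real.sqrt_nonneg (gapFactor p q l (angleParam p q l θ))))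
      refine h3.trans_eq ?_
      simp only [hW]
      ring
    rw [← intervalIntegral.integral_const_mul, ← intervalIntegral.integral_const_mul]
    by_cases hEl : E l
    · simp only [if_pos hEl, one_mul] at hpt
      obtain ⟨-, _, hle⟩ := hEl
      exact intervalIntegral.integral_nonneg hle fun θ _ => hpt θ
    · simp only [if_neg hEl, neg_mul, one_mul] at hpt
      have hle : φ₀ l + 2 * Real.pi ≤ φ₁ l := by
        by_cases hli : l = i
        · rw [hli, hi]
        · by_contra hlt
          exact hEl ⟨fun h => hli (Subtype.ext h), l.2, (not_le.1 hlt).le⟩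
      rw [intervalIntegral.integral_symm, ← intervalIntegral.integral_neg]
      exact intervalIntegral.integral_nonneg hle fun θ _ => hpt θ
  -- The parts already traversed sum to zero by `h0`, so this nonnegative sum is the full-turn sum,
  -- which `hS` makes negative.
  have hfin := Finset.sum_nonneg fun l (_ : l ∈ Finset.univ) => hpos l
  rw [← Finset.mul_sum] at hfin
  simp_rw [hsplit, mul_sub, Finset.sum_sub_distrib] at hfin
  rw [h0, sub_zero] at hfin
  have : ∑ l : Idx n, (-1 : ℝ) ^ (l : ℕ) *
      (2 * ∫ θ in (0 : ℝ)..Real.pi, W l (angleParam p q l θ)) =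
      2 * ∑ l : Idx n, (-1) ^ (l : ℕ) *
        ∫ θ in (0 : ℝ)..Real.pi, W l (angleParam p q l θ) := by
    rw [Finset.mul_sum]
    exact Finset.sum_congr rfl fun l _ => by ring
  rw [this] at hfin
  linarith

end Sign

/-! ### The range and the critical points of the functions `f_i` -/

/-- A differentiable function which is stationary wherever its values lie in an open set is
constant once it takes such a value. -/
theorem eq_const_of_deriv_eq_zero_of_mem {f : ℝ → ℝ} (hf : Differentiable ℝ f) {U : Set ℝ}
    (hU : IsOpen U) (h : ∀ y, f y ∈ U → deriv f y = 0) {y₀ : ℝ} (hy₀ : f y₀ ∈ U) (y : ℝ) :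
    f y = f y₀ := by
  have hclopen : IsClopen {y | f y = f y₀} := by
    refine ⟨isClosed_eq hf.continuous continuous_const, isOpen_iff_mem_nhds.2 fun z hz => ?_⟩
    have hmem : f ⁻¹' U ∈ nhds z := (hU.preimage hf.continuous).mem_nhds (by
      rw [Set.mem_preimage, show f z = f y₀ from hz]; exact hy₀)
    obtain ⟨ε, hε, hball⟩ := Metric.mem_nhds_iff.1 hmem
    refine Filter.mem_of_superset (Metric.ball_mem_nhds z hε) fun w hw => ?_
    have := Metric.isOpen_ball.is_const_of_deriv_eq_zero (convex_ball z ε).isPreconnected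
      hf.differentiableOn (fun x hx => h x (hball hx)) hw (Metric.mem_ball_self hε)
    exact this.trans hz
  have := hclopen.eq_univ ⟨y₀, rfl⟩
  exact (this.symm ▸ Set.mem_univ y : y ∈ {y | f y = f y₀})

theorem card_filter_range_lt {m l : ℕ} (hl : l ≤ m) :
    ((Finset.range m).filter (· < l)).card = l := by
  have : (Finset.range m).filter (· < l) = Finset.range l := by
    ext k; simp only [Finset.mem_filter, Finset.mem_range]; omega
  rw [this, Finset.card_range]

namespace LiouvilleManifold

variable {n : ℕ}

/-- In a neighbouring gap the number `l` of nodes above the value differs from `i` by one. The right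
side of the differential equation then has the wrong sign for a square. -/
theorem deriv_f_eq_zero_of_sign (D : LiouvilleManifold n) (i : Idx n) {y : ℝ} {l : ℕ}
    (hl : l = i + 1 ∨ l + 1 = i) (h₁ : ∀ k, k ≤ n → k < l → D.f i y < D.a k)
    (h₂ : ∀ k, k ≤ n → l ≤ k → D.a k < D.f i y) : deriv (D.f i) y = 0 := by
  have hi := Finset.mem_Icc.1 i.2
  have h := prod_sub_sign (s := Finset.range (n + 1)) (x := D.f i y) (c := D.a) (l := l)
    (fun k hk => h₁ k (Nat.lt_succ_iff.1 (Finset.mem_range.1 hk)))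
    (fun k hk => h₂ k (Nat.lt_succ_iff.1 (Finset.mem_range.1 hk)))
  rw [card_filter_range_lt (by omega)] at h
  have hsign : (-1 : ℝ) ^ (i : ℕ) = -(-1) ^ l := by
    rcases hl with rfl | hl
    · rw [pow_succ]; ring
    · rw [← hl, pow_succ]; ring
  have hode := D.f_ode i i.2 y
  rw [hsign] at hode
  have : deriv (D.f i) y ^ 2 ≤ 0 := by
    rw [hode]
    exact div_nonpos_of_nonpos_of_nonneg (by linarith) (sq_nonneg _)
  exact pow_eq_zero_iff two_ne_zero |>.1 (le_antisymm this (sq_nonneg _))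

theorem f_differentiable (D : LiouvilleManifold n) (i : Idx n) : Differentiable ℝ (D.f i) :=
  (D.f_smooth i i.2).differentiable (by simp)

/-- The ends are barriers: to pass one, `f_i` would take a value in the adjacent gap, where it is
stationary. It would then be constant, against its prescribed value at `0` or at a quarter period.
-/
theorem f_mem (D : LiouvilleManifold n) (i : Idx n) (y : ℝ) :
    D.f i y ∈ Set.Icc (D.a i) (D.a (i - 1)) := by
  have hi := Finset.mem_Icc.1 i.2
  have hd := D.f_differentiable i
  have hlt : D.a i < D.a (i - 1) := D.a_strictAntiOn (by omega) hi.2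
  constructor
  · by_contra hy
    push Not at hy
    -- `u` bounds the gap below `a i`: it is the next node, or an arbitrary smaller number if `i =
    -- n`.
    obtain ⟨u, hu, hu'⟩ : ∃ u < D.a i, ∀ k, k ≤ n → (i : ℕ) < k → D.a k ≤ u := by
      by_cases h : (i : ℕ) = n
      · exact ⟨D.a i - 1, by linarith, fun k hk hk' => by omega⟩
      · exact ⟨D.a (i + 1), D.a_lt i (by omega), fun k hk hk' => D.a_antitone hk' hk⟩
    obtain ⟨v, hv1, hv2⟩ := exists_between (max_lt hu hy)
    obtain ⟨z, -, hz⟩ := intermediate_value_uIcc (a := y) (b := 0) hd.continuous.continuousOn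
      (show v ∈ Set.uIcc (D.f i y) (D.f i 0) by
        rw [D.f_zero i i.2]
        exact Set.Icc_subset_uIcc ⟨((le_max_right _ _).trans_lt hv1).le, hv2.le⟩)
    have hconst := eq_const_of_deriv_eq_zero_of_mem hd (isOpen_Ioo (a := u) (b := D.a i))
      (fun w hw => D.deriv_f_eq_zero_of_sign i (l := i + 1) (Or.inl rfl)
        (fun k hk hk' => hw.2.trans_le (D.a_antitone (by omega) hi.2))
        (fun k hk hk' => (hu' k hk hk').trans_lt hw.1))
      (y₀ := z) (by rw [hz]; exact ⟨(le_max_left _ _).trans_lt hv1, hv2⟩) 0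
    rw [D.f_zero i i.2, hz] at hconst
    linarith
  · by_contra hy
    push Not at hy
    obtain ⟨u, hu, hu'⟩ : ∃ u > D.a (i - 1), ∀ k, k < (i : ℕ) - 1 → u ≤ D.a k := by
      by_cases h : (i : ℕ) = 1
      · exact ⟨D.a (i - 1) + 1, by linarith, fun k hk => by omega⟩
      · exact ⟨D.a (i - 2), D.a_strictAntiOn (by omega) (by omega),
          fun k hk => D.a_antitone (by omega) (by omega)⟩
    obtain ⟨v, hv1, hv2⟩ := exists_between (lt_min hu hy)
    obtain ⟨z, -, hz⟩ := intermediate_value_uIcc (a := D.period i / 4) (b := y)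
      hd.continuous.continuousOn
      (show v ∈ Set.uIcc (D.f i (D.period i / 4)) (D.f i y) by
        rw [D.f_quarter i i.2]
        exact Set.Icc_subset_uIcc ⟨hv1.le, (hv2.trans_le (min_le_right _ _)).le⟩)
    have hconst := eq_const_of_deriv_eq_zero_of_mem hd (isOpen_Ioo (a := D.a (i - 1)) (b := u))
      (fun w hw => D.deriv_f_eq_zero_of_sign i (l := i - 1) (Or.inr (by omega))
        (fun k hk hk' => hw.2.trans_le (hu' k hk'))
        (fun k hk hk' => (D.a_antitone hk' hk).trans_lt hw.1))
      (y₀ := z) (by rw [hz]; exact ⟨hv1, hv2.trans_le (min_le_left _ _)⟩) (D.period i / 4)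
    rw [D.f_quarter i i.2, hz] at hconst
    linarith

theorem f_mem_range (D : LiouvilleManifold n) (i : Idx n) (y : ℝ) :
    D.f i y ∈ Set.Icc (D.a n) (D.a 0) := by
  have hi := Finset.mem_Icc.1 i.2
  exact ⟨(D.a_mem hi.2).1.trans (D.f_mem i y).1,
    (D.f_mem i y).2.trans (D.a_mem (k := (i : ℕ) - 1) (by omega)).2⟩

theorem a_zero_gt (D : LiouvilleManifold n) (i : Idx n) : D.a n < D.a 0 := by
  have hi := Finset.mem_Icc.1 i.2
  exact D.a_strictAntiOn (by omega) le_rfl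

theorem hasDerivWithinAt_A (D : LiouvilleManifold n) {r : ℝ} (hr : r ∈ Set.Icc (D.a n) (D.a 0)) :
    HasDerivWithinAt D.A (derivWithin D.A (Set.Icc (D.a n) (D.a 0)) r)
      (Set.Icc (D.a n) (D.a 0)) r :=
  ((D.A_smooth.differentiableOn (by simp)) r hr).hasDerivWithinAt

theorem A_ne_zero (D : LiouvilleManifold n) (i : Idx n) (y : ℝ) : D.A (D.f i y) ≠ 0 :=
  (D.A_pos _ (D.f_mem_range i y)).ne'

theorem deriv_f_sq_mul (D : LiouvilleManifold n) (i : Idx n) (y : ℝ) :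
    deriv (D.f i) y ^ 2 * D.A (D.f i y) ^ 2 =
      (-1) ^ (i : ℕ) * 4 * ∏ j ∈ Finset.range (n + 1), (D.f i y - D.a j) := by
  rw [D.f_ode i i.2 y, div_mul_cancel₀ _ (pow_ne_zero 2 (D.A_ne_zero i y))]

theorem a_injOn_range (D : LiouvilleManifold n) :
    Set.InjOn D.a (Finset.range (n + 1) : Finset ℕ) := by
  intro i hi j hj h
  have hi := Finset.mem_range.1 hi
  have hj := Finset.mem_range.1 hj
  rcases lt_trichotomy i j with h' | h' | h'
  · exact absurd h (D.a_strictAntiOn h' (by omega)).ne'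
  · exact h'
  · exact absurd h (D.a_strictAntiOn h' (by omega)).ne

open Polynomial in
/-- The critical points of `f_i` are nondegenerate. -/
theorem deriv_deriv_f_ne_zero (D : LiouvilleManifold n) (i : Idx n) {y₀ : ℝ}
    (h₀ : deriv (D.f i) y₀ = 0) : deriv (deriv (D.f i)) y₀ ≠ 0 := by
  intro h₀'
  have hi := Finset.mem_Icc.1 i.2
  set f := D.f i with hf
  set S := Set.Icc (D.a n) (D.a 0) with hS
  have hdf : Differentiable ℝ f := D.f_differentiable i
  have hsm : ContDiff ℝ ∞ f := D.f_smooth i i.2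
  have hsm' : ContDiff ℝ ∞ (deriv f) := (contDiff_infty_iff_deriv.1 hsm).2
  have hsm'' : ContDiff ℝ ∞ (deriv (deriv f)) := (contDiff_infty_iff_deriv.1 hsm').2
  have hddf : Differentiable ℝ (deriv f) := hsm'.differentiable (by simp)
  set L := Lagrange.nodal (Finset.range (n + 1)) D.a with hL
  have hmem : ∀ y, f y ∈ S := D.f_mem_range i
  -- Differentiating the equation gives `f' * V = 0`. At a degenerate critical point only the `L'`
  -- term of `V` survives, and it is nonzero because the nodes are simple. `derivWithin` is needed
  -- as `f` may reach `a 0` or `a n`.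
  set V : ℝ → ℝ := fun y => 2 * deriv (deriv f) y * D.A (f y) ^ 2 +
    2 * deriv f y ^ 2 * D.A (f y) * derivWithin D.A S (f y) -
      4 * (-1) ^ (i : ℕ) * (derivative L).eval (f y) with hV
  have hode : ∀ y, deriv f y ^ 2 * D.A (f y) ^ 2 = (-1) ^ (i : ℕ) * 4 * L.eval (f y) := fun y => by
    rw [hL, Lagrange.eval_nodal]; exact D.deriv_f_sq_mul i y
  have hVzero : ∀ y, deriv f y * V y = 0 := by
    intro y
    have hA : HasDerivAt (fun y => D.A (f y)) (derivWithin D.A S (f y) * deriv f y) y :=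
      (D.hasDerivWithinAt_A (hmem y)).comp_hasDerivAt y (hdf y).hasDerivAt
        (Filter.Eventually.of_forall hmem)
    have h1 := ((hddf y).hasDerivAt.fun_pow 2).fun_mul (hA.fun_pow 2)
    have h2 := ((L.hasDerivAt (f y)).comp y (hdf y).hasDerivAt).const_mul ((-1) ^ (i : ℕ) * 4)
    have h3 := h1.unique (h2.congr_of_eventuallyEq (Filter.Eventually.of_forall hode))
    simp only [hV]
    norm_num at h3
    linear_combination h3
  have hAc : ContinuousOn D.A S := D.A_smooth.continuousOn
  have hA'c : ContinuousOn (derivWithin D.A S) S :=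
    D.A_smooth.continuousOn_derivWithin (uniqueDiffOn_Icc (D.a_zero_gt i)) (by simp)
  have hVc : Continuous V := by
    have c1 : Continuous fun y => D.A (f y) := hAc.comp_continuous hdf.continuous hmem
    have c2 : Continuous fun y => derivWithin D.A S (f y) := hA'c.comp_continuous hdf.continuous hmem
    have c3 : Continuous fun y => (derivative L).eval (f y) :=
      (derivative L).continuous.comp hdf.continuous
    have c4 := hsm'.continuous
    have c5 := hsm''.continuous
    simp only [hV]
    fun_prop
  have hroot : L.eval (f y₀) = 0 := by
    have := hode y₀
    rw [h₀] at this
    have h1 : (-1 : ℝ) ^ (i : ℕ) * 4 ≠ 0 := by simp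
    rw [zero_pow two_ne_zero, zero_mul] at this
    exact (mul_eq_zero.1 this.symm).resolve_left h1
  have hL' : (derivative L).eval (f y₀) ≠ 0 := by
    rw [hL, Lagrange.eval_nodal] at hroot
    obtain ⟨j, hj, hj'⟩ := Finset.prod_eq_zero_iff.1 hroot
    rw [sub_eq_zero.1 hj', hL, Lagrange.eval_nodal_derivative_eval_node_eq hj, Lagrange.eval_nodal]
    refine Finset.prod_ne_zero_iff.2 fun k hk h => ?_
    exact Finset.ne_of_mem_erase hk
      (D.a_injOn_range (Finset.mem_of_mem_erase hk) hj (sub_eq_zero.1 h).symm)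
  -- Where `V ≠ 0`, `f` is locally constant, so degeneracy at one point spreads to the whole line
  -- and contradicts `f 0 ≠ f (period / 4)`.
  have hclopen : IsClopen {y | f y = f y₀ ∧ deriv f y = 0 ∧ deriv (deriv f) y = 0} := by
    constructor
    · exact (isClosed_eq hdf.continuous continuous_const).inter
        ((isClosed_eq hsm'.continuous continuous_const).inter
          (isClosed_eq hsm''.continuous continuous_const))
    · refine isOpen_iff_mem_nhds.2 fun z ⟨hz1, hz2, hz3⟩ => ?_
      have hVz : V z ≠ 0 := by
        simp only [hV]
        rw [hz1, hz2, hz3]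
        simpa using hL'
      obtain ⟨ε, hε, hball⟩ := Metric.mem_nhds_iff.1
        ((isOpen_ne_fun hVc continuous_const).mem_nhds hVz)
      have hzero : ∀ x ∈ Metric.ball z ε, deriv f x = 0 := fun x hx =>
        (mul_eq_zero.1 (hVzero x)).resolve_right (hball hx)
      refine Filter.mem_of_superset (Metric.ball_mem_nhds z hε) fun w hw => ⟨?_, hzero w hw, ?_⟩
      · have := Metric.isOpen_ball.is_const_of_deriv_eq_zero (convex_ball z ε).isPreconnected
          hdf.differentiableOn hzero hw (Metric.mem_ball_self hε)
        exact this.trans hz1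
      · have : deriv f =ᶠ[nhds w] fun _ => 0 :=
          Filter.eventually_of_mem (Metric.isOpen_ball.mem_nhds hw) hzero
        rw [this.deriv_eq, deriv_const]
  have huniv := hclopen.eq_univ ⟨y₀, rfl, h₀, h₀'⟩
  have hconst : ∀ y, f y = f y₀ := fun y =>
    (huniv.symm ▸ Set.mem_univ y : y ∈ {y | f y = f y₀ ∧ deriv f y = 0 ∧ deriv (deriv f) y = 0}).1
  have h1 := D.f_zero i i.2
  have h2 := D.f_quarter i i.2
  have h3 : D.a i < D.a (i - 1) := D.a_strictAntiOn (by omega) hi.2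
  rw [← hf, hconst] at h1 h2
  linarith

end LiouvilleManifold

/-! ### The first integrals and the separated momenta -/

namespace LiouvilleManifold

open Polynomial

variable {n : ℕ}

theorem strictAnti_of_regular (D : LiouvilleManifold n) {x : Idx n → ℝ} (hx : D.Regular x) :
    StrictAnti fun i : Idx n => D.f i (x i) := by
  intro k l hkl
  have hk := Finset.mem_Icc.1 k.2
  have hl := Finset.mem_Icc.1 l.2
  have hkl' : (k : ℕ) < l := hkl
  have h1 := (D.f_mem k (x k)).1
  have h2 := (D.f_mem l (x l)).2
  have h3 : D.a (l - 1) ≤ D.a k := D.a_antitone (by omega) (by omega)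
  refine lt_of_le_of_ne (h2.trans (h3.trans h1)) fun h => ?_
  by_cases hs : (l : ℕ) = k + 1
  · exact hx k l hs h.symm
  · have h4 : D.a (l - 1) < D.a k := D.a_strictAntiOn (by omega) (by omega)
    simp only at h
    linarith

/-- Reversing the `n - 1` differences turns the sign into `-(-1)^i`, the form in which partial
fractions apply. -/
theorem metricCoeff_eq (D : LiouvilleManifold n) (x : Idx n → ℝ) (i : Idx n) :
    D.metricCoeff x i =
      -((-1) ^ (i : ℕ) * ∏ k ∈ Finset.univ.erase i, (D.f i (x i) - D.f k (x k))) := by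
  have hi := Finset.mem_Icc.1 i.2
  have h1 : ∏ l ∈ Finset.univ.erase i, (D.f l (x l) - D.f i (x i)) =
      (-1) ^ (n - 1) * ∏ l ∈ Finset.univ.erase i, (D.f i (x i) - D.f l (x l)) := by
    have : (Finset.univ.erase i).card = n - 1 := by
      rw [Finset.card_erase_of_mem (Finset.mem_univ i), Idx.card_univ]
    rw [← this, ← Finset.prod_const, ← Finset.prod_mul_distrib]
    exact Finset.prod_congr rfl fun _ _ => by ring
  obtain ⟨m, hm⟩ := Nat.exists_eq_add_of_le hi.2
  obtain ⟨j, hj⟩ := Nat.exists_eq_add_of_le' hi.1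
  have h2 : (-1 : ℝ) ^ (n - (i : ℕ)) * (-1) ^ (n - 1) = -(-1) ^ (i : ℕ) := by
    rw [show n - (i : ℕ) = m by omega, show n - 1 = j + m by omega, hj, pow_add, pow_succ]
    have : (-1 : ℝ) ^ m * (-1) ^ m = 1 := by rw [← mul_pow]; simp
    linear_combination (-1) ^ j * this
  rw [metricCoeff, h1, ← mul_assoc, h2]
  ring

theorem metricCoeff_pos (D : LiouvilleManifold n) {x : Idx n → ℝ} (hx : D.Regular x) (i : Idx n) :
    0 < D.metricCoeff x i := by
  rw [metricCoeff_eq]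
  have := prod_erase_sub_sign (D.strictAnti_of_regular hx) i
  linarith

theorem metricCoeff_eq_abs (D : LiouvilleManifold n) {x : Idx n → ℝ} (hx : D.Regular x)
    (i : Idx n) : D.metricCoeff x i =
      |∏ k ∈ Finset.univ.erase i, (D.f i (x i) - D.f k (x k))| := by
  rw [metricCoeff_eq, abs_eq_neg_of_sign (prod_erase_sub_sign (D.strictAnti_of_regular hx) i)]

/-- The polynomial `Θ` whose zeros are the constants `b_1, …, b_{n-1}`. -/
noncomputable def thetaPoly (n : ℕ) (b : ℕ → ℝ) : ℝ[X] :=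
  -Lagrange.nodal (Finset.Icc 1 (n - 1)) b

theorem eval_thetaPoly (b : ℕ → ℝ) (r : ℝ) :
    (thetaPoly n b).eval r = -∏ k ∈ Finset.Icc 1 (n - 1), (r - b k) := by
  rw [thetaPoly, eval_neg, Lagrange.eval_nodal]

/-- The difference between `ξ_i²` and the value which is predicted by the first integrals. -/
noncomputable def defect (D : LiouvilleManifold n) (b : ℕ → ℝ) (x ξ : Idx n → ℝ) (i : Idx n) : ℝ :=
  ξ i ^ 2 - (-1) ^ (i : ℕ) * (thetaPoly n b).eval (D.f i (x i))

theorem coeff_nodal_card {ι : Type*} (s : Finset ι) (v : ι → ℝ) :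
    (Lagrange.nodal s v).coeff s.card = 1 := by
  have := (Lagrange.nodal_monic (s := s) (v := v)).coeff_natDegree
  rwa [Lagrange.natDegree_nodal] at this

/-- Lagrange's coefficient formula at the nodes `f_i(x_i)` reads off the leading coefficient `-1` of
`Θ`. In effect, the separated values of `ξ_i²` have unit energy. As an identity on the whole regular
set it may be differentiated. -/
theorem sum_theta_div_metricCoeff (D : LiouvilleManifold n) (hn : 1 ≤ n) (b : ℕ → ℝ)
    {x : Idx n → ℝ} (hx : D.Regular x) :
    ∑ i : Idx n, (-1) ^ (i : ℕ) * (thetaPoly n b).eval (D.f i (x i)) / D.metricCoeff x i = 1 := by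
  have hanti := D.strictAnti_of_regular hx
  have hcard : (Finset.Icc 1 (n - 1)).card = n - 1 := by simp
  have hdeg : (thetaPoly n b).degree < (Finset.univ : Finset (Idx n)).card := by
    rw [thetaPoly, degree_neg, Lagrange.degree_nodal, hcard, Idx.card_univ]
    exact_mod_cast (by omega : n - 1 < n)
  have h := Lagrange.coeff_eq_sum (s := Finset.univ) hanti.injective.injOn hdeg
  have hc := coeff_nodal_card (Finset.Icc 1 (n - 1)) b
  rw [hcard] at hc
  rw [Idx.card_univ, thetaPoly, coeff_neg, hc, ← thetaPoly] at h
  refine Eq.trans ?_ (neg_eq_iff_eq_neg.1 h).symm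
  rw [← Finset.sum_neg_distrib]
  refine Finset.sum_congr rfl fun i _ => ?_
  have hs := prod_erase_sub_sign hanti i
  have h0 : ∏ k ∈ Finset.univ.erase i, (D.f i (x i) - D.f k (x k)) ≠ 0 := fun h0 => by
    simp only [h0, mul_zero, lt_irrefl] at hs
  have h1 : ((-1 : ℝ) ^ (i : ℕ)) ≠ 0 := by simp
  rw [metricCoeff_eq]
  field_simp

/-- The covector is determined up to signs by the constants. -/
theorem defect_eq_zero_of_hasConstants (D : LiouvilleManifold n) (hn : 2 ≤ n) {b : ℕ → ℝ}
    {x ξ : Idx n → ℝ} (hx : D.Regular x) (hE : 2 * D.energy x ξ = 1)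
    (hb : D.HasConstants x ξ b) (i : Idx n) : D.defect b x ξ i = 0 := by
  set F : Idx n → ℝ := fun i => D.f i (x i) with hF
  set s := Finset.Icc 1 (n - 1) with hs
  have hscard : s.card = n - 1 := by simp [hs]
  have hsub : s ⊆ Finset.Icc 1 n := Finset.Icc_subset_Icc_right (by omega)
  have hinj : Set.InjOn D.a s := D.a_injOn.mono (by exact_mod_cast hsub)
  have hg : ∀ i, D.metricCoeff x i ≠ 0 := fun i => (D.metricCoeff_pos hx i).ne'
  -- `H` turns out to be `Θ`: its leading coefficient is `-1` by unit energy, and the first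
  -- integrals are its values at the `a j` up to node products. At `F i` only the `i`-th summand
  -- survives, with value `(-1)^i ξ_i²`.
  set H : ℝ[X] := -∑ i, C (ξ i ^ 2 / D.metricCoeff x i) * Lagrange.nodal (Finset.univ.erase i) F
    with hH
  have hcard : ∀ i : Idx n, (Finset.univ.erase i).card = n - 1 := fun i => by
    rw [Finset.card_erase_of_mem (Finset.mem_univ i), Idx.card_univ]
  have hHeval : ∀ r, H.eval r =
      -∑ i, ξ i ^ 2 / D.metricCoeff x i * ∏ l ∈ Finset.univ.erase i, (r - F l) := fun r => by
    rw [hH, eval_neg, eval_finsetSum]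
    simp only [eval_mul, eval_C, Lagrange.eval_nodal]
  have hE' : ∑ i, ξ i ^ 2 / D.metricCoeff x i = 1 := by
    rw [energy] at hE; linarith
  have hHcoeff : H.coeff (n - 1) = -1 := by
    rw [hH, coeff_neg, finsetSum_coeff, neg_inj, ← hE']
    refine Finset.sum_congr rfl fun i _ => ?_
    have := coeff_nodal_card (Finset.univ.erase i) F
    rw [hcard] at this
    rw [coeff_C_mul, this, mul_one]
  have hHdeg : H.natDegree ≤ n - 1 := by
    rw [hH, natDegree_neg]
    refine natDegree_sum_le_of_forall_le _ _ fun i _ => ?_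
    exact (natDegree_C_mul_le _ _).trans (by rw [Lagrange.natDegree_nodal, hcard])
  have hFj : ∀ j ∈ s, D.firstIntegral j x ξ = H.eval (D.a j) / ∏ k ∈ s.erase j, (D.a j - D.a k) := by
    intro j hj
    have h1 : ∏ k ∈ s.erase j, (D.a k - D.a j) =
        (-1) ^ (n - 2) * ∏ k ∈ s.erase j, (D.a j - D.a k) := by
      have : (s.erase j).card = n - 2 := by rw [Finset.card_erase_of_mem hj, hscard]; omega
      rw [← this, ← Finset.prod_const, ← Finset.prod_mul_distrib]
      exact Finset.prod_congr rfl fun _ _ => by ring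
    have h2 : ∀ i : Idx n, ∏ l ∈ Finset.univ.erase i, (D.f l (x l) - D.a j) =
        (-1) ^ (n - 1) * ∏ l ∈ Finset.univ.erase i, (D.a j - F l) := fun i => by
      rw [← hcard i, ← Finset.prod_const, ← Finset.prod_mul_distrib]
      exact Finset.prod_congr rfl fun _ _ => by simp only [hF]; ring
    have h3 : ∀ i : Idx n, (-1) ^ (n - (i : ℕ)) *
        (∏ l ∈ Finset.univ.erase i, (D.f l (x l) - D.a j)) /
        (∏ l ∈ Finset.univ.erase i, (D.f l (x l) - D.f i (x i))) * ξ i ^ 2 =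
        (-1) ^ (n - 1) * (ξ i ^ 2 / D.metricCoeff x i *
          ∏ l ∈ Finset.univ.erase i, (D.a j - F l)) := fun i => by
      have h4 := hg i
      rw [metricCoeff] at h4 ⊢
      have h5 := right_ne_zero_of_mul h4
      have h6 : ((-1 : ℝ) ^ (n - (i : ℕ))) * (-1) ^ (n - (i : ℕ)) = 1 := by
        rw [← mul_pow]; simp
      rw [h2]
      have h7 : ((-1 : ℝ) ^ (n - (i : ℕ))) ≠ 0 := by simp
      field_simp
      linear_combination (ξ i ^ 2 * ∏ l ∈ Finset.univ.erase i, (D.a j - F l)) * h6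
    rw [firstIntegral, Finset.sum_congr rfl fun i _ => h3 i, ← Finset.mul_sum, h1, hHeval]
    have h8 : (-1 : ℝ) ^ (n - 1) = -(-1) ^ (n - 2) := by
      rw [show n - 1 = n - 2 + 1 by omega, pow_succ]; ring
    have h9 : ((-1 : ℝ) ^ (n - 2)) ≠ 0 := by simp
    have h10 : ∏ k ∈ s.erase j, (D.a j - D.a k) ≠ 0 := by
      refine Finset.prod_ne_zero_iff.2 fun k hk h => Finset.ne_of_mem_erase hk ?_
      exact hinj (Finset.mem_of_mem_erase hk) hj (sub_eq_zero.1 h).symm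
    rw [h8]
    field_simp
  -- The leading terms cancel, so `n - 1` values determine the sum, and the nodal polynomial does
  -- not affect the values at the `a j`.
  have hinterp : H + Lagrange.nodal s D.a =
      Lagrange.interpolate s D.a fun j => H.eval (D.a j) := by
    refine Lagrange.eq_interpolate_of_eval_eq _ hinj ?_ fun j hj => by
      rw [eval_add, Lagrange.eval_nodal_at_node hj, add_zero]
    rw [hscard, degree_lt_iff_coeff_zero]
    intro m hm
    rcases hm.eq_or_lt with rfl | hm
    · have := coeff_nodal_card s D.a
      rw [hscard] at this
      rw [coeff_add, hHcoeff, this, neg_add_cancel]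
    · rw [coeff_add, coeff_eq_zero_of_natDegree_lt (hHdeg.trans_lt hm),
        coeff_eq_zero_of_natDegree_lt (by rw [Lagrange.natDegree_nodal, hscard]; exact hm),
        add_zero]
  have hr := hb.2 (F i)
  have hev := congrArg (eval (F i)) hinterp
  rw [Lagrange.interpolate_eq_sum, eval_add, Lagrange.eval_nodal, eval_finsetSum] at hev
  simp only [eval_mul, eval_C, eval_prod, eval_sub, eval_X] at hev
  rw [Finset.sum_congr rfl fun j hj => by rw [hFj j hj, mul_comm], ← hev, add_sub_cancel_right,
    hHeval] at hr
  rw [Finset.sum_eq_single i] at hr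
  · rw [defect, eval_thetaPoly, ← hr]
    have h4 := hg i
    rw [metricCoeff_eq] at h4 ⊢
    have h7 : ((-1 : ℝ) ^ (i : ℕ)) ≠ 0 := by simp
    have h5 := right_ne_zero_of_mul (neg_ne_zero.1 h4)
    simp only [hF]
    field_simp
    ring
  · intro l _ hl
    rw [Finset.prod_eq_zero (f := fun l => F i - F l)
      (Finset.mem_erase.2 ⟨hl.symm, Finset.mem_univ i⟩) (sub_self _), mul_zero]
  · exact fun h => absurd (Finset.mem_univ i) h

end LiouvilleManifold

/-! ### The intervals of oscillation and the derivatives of the energy -/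

namespace LiouvilleManifold

open Polynomial

variable {n : ℕ}

theorem constants_antitone {b : ℕ → ℝ} (hb : ∀ i, 1 ≤ i → i + 1 ≤ n - 1 → b (i + 1) ≤ b i)
    {i j : ℕ} (hi : 1 ≤ i) (hij : i ≤ j) (hj : j ≤ n - 1) : b j ≤ b i := by
  induction j, hij using Nat.le_induction with
  | base => exact le_rfl
  | succ k hk ih => exact (hb k (by omega) hj).trans (ih (by omega))

/-- The zeros of `Θ` separate the values `f_i(x_i)`. -/
theorem constants_interlace {b : ℕ → ℝ}
    (hb : ∀ i, 1 ≤ i → i + 1 ≤ n - 1 → b (i + 1) ≤ b i) {F : Idx n → ℝ} (hF : StrictAnti F)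
    (hsign : ∀ i : Idx n, 0 ≤ (-1) ^ (i : ℕ) * (thetaPoly n b).eval (F i)) :
    ∀ k, 1 ≤ k → k ≤ n - 1 → ∀ i : Idx n, ((i : ℕ) = k → b k ≤ F i) ∧
      ((i : ℕ) = k + 1 → F i ≤ b k) := by
  have hsign' : ∀ i : Idx n,
      (-1) ^ (i : ℕ) * ∏ k ∈ Finset.Icc 1 (n - 1), (F i - b k) ≤ 0 := fun i => by
    have := hsign i
    rw [eval_thetaPoly] at this
    linarith
  -- If `b k < F i` with `i = k + 1`, the earlier cases leave exactly `k - 1` zeros of `Θ` above `F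
  -- i`, so `Θ` has the wrong sign there.
  have hlow : ∀ k, 1 ≤ k → k ≤ n - 1 → ∀ i : Idx n, (i : ℕ) = k + 1 → F i ≤ b k := by
    intro k
    induction k using Nat.strong_induction_on with
    | _ k ih =>
      intro hk1 hkn i hi
      by_contra hlt
      push Not at hlt
      have h := prod_sub_sign (s := Finset.Icc 1 (n - 1)) (x := F i) (c := b) (l := k)
        (fun j hj hjk => by
          have hj := Finset.mem_Icc.1 hj
          have hmem : j + 1 ∈ Finset.Icc 1 n := Finset.mem_Icc.2 ⟨by omega, by omega⟩
          have h1 := ih j hjk hj.1 hj.2 ⟨j + 1, hmem⟩ rfl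
          have h2 : F i < F ⟨j + 1, hmem⟩ := hF (by rw [← Subtype.coe_lt_coe]; simp only; omega)
          linarith)
        (fun j hj hjk => (constants_antitone hb hk1 hjk (Finset.mem_Icc.1 hj).2).trans_lt hlt)
      rw [card_filter_Icc_lt hk1 (by omega)] at h
      have h' := neg_one_pow_mul_pos_of_sub_one hk1 h
      have := hsign' i
      rw [hi, pow_succ] at this
      linarith
  -- The mirror image, by induction downwards in `k` through `d = n - 1 - k`.
  have hup : ∀ d k, k + d = n - 1 → 1 ≤ k → ∀ i : Idx n, (i : ℕ) = k → b k ≤ F i := by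
    intro d
    induction d using Nat.strong_induction_on with
    | _ d ih =>
      intro k hd hk1 i hi
      by_contra hlt
      push Not at hlt
      have h := prod_sub_sign (s := Finset.Icc 1 (n - 1)) (x := F i) (c := b) (l := k + 1)
        (fun j hj hjk =>
          hlt.trans_le (constants_antitone hb (Finset.mem_Icc.1 hj).1 (by omega) (by omega)))
        (fun j hj hjk => by
          have hj := Finset.mem_Icc.1 hj
          have hmem : j ∈ Finset.Icc 1 n := Finset.mem_Icc.2 ⟨by omega, by omega⟩
          have h1 := ih (n - 1 - j) (by omega) j (by omega) hj.1 ⟨j, hmem⟩ rfl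
          have h2 : F ⟨j, hmem⟩ < F i := hF (by rw [← Subtype.coe_lt_coe]; simp only; omega)
          linarith)
      rw [card_filter_Icc_lt (by omega) (by omega), Nat.add_sub_cancel] at h
      have := hsign' i
      rw [hi] at this
      linarith
  exact fun k hk1 hkn i => ⟨fun hi => hup (n - 1 - k) k (by omega) hk1 i hi, hlow k hk1 hkn i⟩

/-- The lower end of the range of `f_i(x_i)`. -/
noncomputable abbrev lower (D : LiouvilleManifold n) (b : ℕ → ℝ) (i : Idx n) : ℝ := D.aPlus b i

/-- The upper end of the range of `f_i(x_i)`. -/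
noncomputable abbrev upper (D : LiouvilleManifold n) (b : ℕ → ℝ) (i : Idx n) : ℝ :=
  D.aMinus b ((i : ℕ) - 1)

theorem a_le_lower (D : LiouvilleManifold n) (b : ℕ → ℝ) (i : Idx n) :
    D.a i ≤ D.lower b i := by
  rw [lower, aPlus]
  split_ifs with h
  · rw [h]
  · exact le_max_left _ _

theorem upper_le_a (D : LiouvilleManifold n) (b : ℕ → ℝ) (i : Idx n) :
    D.upper b i ≤ D.a (i - 1) := by
  rw [upper, aMinus]
  split_ifs with h
  · rw [h]
  · exact min_le_left _ _

theorem f_mem_of_interlace (D : LiouvilleManifold n) {b : ℕ → ℝ}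
    (hb : ∀ i, 1 ≤ i → i + 1 ≤ n - 1 → b (i + 1) ≤ b i) {x : Idx n → ℝ} (hx : D.Regular x)
    (hsign : ∀ i : Idx n, 0 ≤ (-1) ^ (i : ℕ) * (thetaPoly n b).eval (D.f i (x i))) (i : Idx n) :
    D.f i (x i) ∈ Set.Icc (D.lower b i) (D.upper b i) := by
  have hi := Finset.mem_Icc.1 i.2
  have h := constants_interlace hb (D.strictAnti_of_regular hx) hsign
  have hf := D.f_mem i (x i)
  constructor
  · rw [lower, aPlus]
    split_ifs with hin
    · exact (congrArg D.a hin).ge.trans hf.1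
    · exact max_le hf.1 ((h i hi.1 (by omega) i).1 rfl)
  · rw [upper, aMinus]
    split_ifs with hin
    · rw [← hin]; exact hf.2
    · exact le_min hf.2 ((h (i - 1) (by omega) (by omega) i).2 (by omega))

/-- The constants `b_1, …, b_{n-1}, a_0, …, a_n` are distinct. -/
structure DistinctConstants (D : LiouvilleManifold n) (b : ℕ → ℝ) : Prop where
  bb : ∀ i ∈ Finset.Icc 1 (n - 1), ∀ j ∈ Finset.Icc 1 (n - 1), i ≠ j → b i ≠ b j
  ba : ∀ i ∈ Finset.Icc 1 (n - 1), ∀ j ∈ Finset.range (n + 1), b i ≠ D.a j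

/-- Neighbouring intervals are separated by the gap between `min (a k) (b k)` and `max (a k) (b k)`,
which is nonempty because `a k ≠ b k`. -/
theorem upper_lt_lower (D : LiouvilleManifold n) {b : ℕ → ℝ} (hd : D.DistinctConstants b)
    (k l : Idx n) (hkl : k < l) : D.upper b l < D.lower b k := by
  have hk := Finset.mem_Icc.1 k.2
  have hl := Finset.mem_Icc.1 l.2
  have hkl' : (k : ℕ) < l := hkl
  by_cases h : (l : ℕ) = k + 1
  · have hne := hd.ba k (Finset.mem_Icc.2 ⟨hk.1, by omega⟩) k (Finset.mem_range.2 (by omega))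
    rw [upper, lower, aMinus, aPlus, if_neg (by omega), if_neg (by omega), h, Nat.add_sub_cancel]
    rcases lt_or_gt_of_ne hne with h' | h'
    · rw [min_eq_right h'.le, max_eq_left h'.le]; exact h'
    · rw [min_eq_left h'.le, max_eq_right h'.le]; exact h'
  · exact (D.upper_le_a b l).trans_lt
      ((D.a_strictAntiOn (i := k) (j := l - 1) (by omega) (by omega)).trans_le (D.a_le_lower b k))

/-- Distinctness alone gives only `≠`. The order of the ends needs a point between them, which
`lower_lt_upper` takes from the geodesic. -/
theorem lower_ne_upper (D : LiouvilleManifold n) {b : ℕ → ℝ} (hd : D.DistinctConstants b)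
    (l : Idx n) : D.lower b l ≠ D.upper b l := by
  have hl := Finset.mem_Icc.1 l.2
  have haa : D.a l ≠ D.a (l - 1) := (D.a_strictAntiOn (by omega) hl.2).ne
  have hba : ∀ i j : ℕ, 1 ≤ i → i ≤ n - 1 → j ≤ n → b i ≠ D.a j := fun i j h1 h2 h3 =>
    hd.ba i (Finset.mem_Icc.2 ⟨h1, h2⟩) j (Finset.mem_range.2 (by omega))
  have hlow : D.lower b l = D.a l ∨ ((l : ℕ) ≠ n ∧ D.lower b l = b l) := by
    rw [lower, aPlus]
    split_ifs with h
    · exact Or.inl (by rw [h])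
    · rcases max_choice (D.a l) (b l) with h' | h'
      · exact Or.inl h'
      · exact Or.inr ⟨h, h'⟩
  have hupp : D.upper b l = D.a (l - 1) ∨ ((l : ℕ) - 1 ≠ 0 ∧ D.upper b l = b (l - 1)) := by
    rw [upper, aMinus]
    split_ifs with h
    · exact Or.inl (by rw [h])
    · rcases min_choice (D.a (l - 1)) (b (l - 1)) with h' | h'
      · exact Or.inl h'
      · exact Or.inr ⟨h, h'⟩
  rcases hlow with h1 | ⟨h0, h1⟩ <;> rcases hupp with h2 | ⟨h3, h2⟩ <;> rw [h1, h2]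
  · exact haa
  · exact (hba _ _ (by omega) (by omega) hl.2).symm
  · exact hba _ _ hl.1 (by omega) (by omega)
  · exact hd.bb _ (Finset.mem_Icc.2 ⟨hl.1, by omega⟩) _ (Finset.mem_Icc.2 ⟨by omega, by omega⟩)
      (by omega)

theorem regular_of_mem (D : LiouvilleManifold n) {b : ℕ → ℝ} (hd : D.DistinctConstants b)
    {x : Idx n → ℝ} (h : ∀ i : Idx n, D.f i (x i) ∈ Set.Icc (D.lower b i) (D.upper b i)) :
    D.Regular x := fun i j hij => by
  have := D.upper_lt_lower hd i j (by rw [← Subtype.coe_lt_coe]; omega)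
  exact (((h j).2.trans_lt this).trans_le (h i).1).ne'

theorem isOpen_regular (D : LiouvilleManifold n) : IsOpen {x : Idx n → ℝ | D.Regular x} := by
  simp only [Regular, Set.ofPred_forall]
  refine isOpen_iInter_of_finite fun i => isOpen_iInter_of_finite fun j =>
    isOpen_iInter_of_finite fun _ => ?_
  exact isOpen_ne_fun ((D.f_differentiable i).continuous.comp (continuous_apply i))
    ((D.f_differentiable j).continuous.comp (continuous_apply j))

/-- The partial derivative of the coefficient of `dx_l²` with respect to `x_i`. -/
noncomputable def metricCoeffDeriv (D : LiouvilleManifold n) (x : Idx n → ℝ) (i l : Idx n) : ℝ :=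
  (-1) ^ (n - (l : ℕ)) * ∑ k ∈ Finset.univ.erase l,
    (∏ j ∈ (Finset.univ.erase l).erase k, (D.f j (x j) - D.f l (x l))) *
      ((if k = i then deriv (D.f i) (x i) else 0) - (if l = i then deriv (D.f i) (x i) else 0))

theorem hasDerivAt_f_update (D : LiouvilleManifold n) (x : Idx n → ℝ) (i k : Idx n) :
    HasDerivAt (fun y => D.f k (Function.update x i y k))
      (if k = i then deriv (D.f i) (x i) else 0) (x i) := by
  split_ifs with h
  · subst h
    simpa using (D.f_differentiable k (x k)).hasDerivAt
  · simpa [Function.update_of_ne h] using hasDerivAt_const (x i) (D.f k (x k))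

theorem hasDerivAt_metricCoeff (D : LiouvilleManifold n) (x : Idx n → ℝ) (i l : Idx n) :
    HasDerivAt (fun y => D.metricCoeff (Function.update x i y) l)
      (D.metricCoeffDeriv x i l) (x i) := by
  have h := HasDerivAt.fun_finsetProd (u := Finset.univ.erase l)
    (f := fun (k : Idx n) y => D.f k (Function.update x i y k) - D.f l (Function.update x i y l))
    (fun k _ => (D.hasDerivAt_f_update x i k).fun_sub (D.hasDerivAt_f_update x i l))
  simp only [Function.update_eq_self, smul_eq_mul] at h
  exact h.const_mul _

theorem continuous_deriv_f (D : LiouvilleManifold n) (i : Idx n) : Continuous (deriv (D.f i)) :=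
  (D.f_smooth i i.2).continuous_deriv (by simp)

theorem continuous_metricCoeffDeriv (D : LiouvilleManifold n) (i l : Idx n) :
    Continuous fun x => D.metricCoeffDeriv x i l := by
  unfold metricCoeffDeriv
  have h1 : ∀ k : Idx n, Continuous fun x : Idx n → ℝ => D.f k (x k) := fun k =>
    (D.f_differentiable k).continuous.comp (continuous_apply k)
  have h2 : Continuous fun x : Idx n → ℝ => deriv (D.f i) (x i) :=
    (D.continuous_deriv_f i).comp (continuous_apply i)
  refine continuous_const.mul (continuous_finsetSum _ fun k _ => Continuous.mul ?_ ?_)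
  · exact continuous_finsetProd _ fun j _ => (h1 j).sub (h1 l)
  · refine Continuous.sub ?_ ?_ <;> split_ifs <;> first | exact h2 | exact continuous_const

theorem continuous_metricCoeff (D : LiouvilleManifold n) (l : Idx n) :
    Continuous fun x => D.metricCoeff x l := by
  unfold metricCoeff
  have h1 : ∀ k : Idx n, Continuous fun x : Idx n → ℝ => D.f k (x k) := fun k =>
    (D.f_differentiable k).continuous.comp (continuous_apply k)
  exact continuous_const.mul (continuous_finsetProd _ fun j _ => (h1 j).sub (h1 l))

/-- The partial derivative of `1 / g_l` with respect to `x_i`. -/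
noncomputable def invMetricDeriv (D : LiouvilleManifold n) (x : Idx n → ℝ) (i l : Idx n) : ℝ :=
  -D.metricCoeffDeriv x i l / D.metricCoeff x l ^ 2

theorem hasDerivAt_inv_metricCoeff (D : LiouvilleManifold n) {x : Idx n → ℝ} (hx : D.Regular x)
    (i l : Idx n) :
    HasDerivAt (fun y => (D.metricCoeff (Function.update x i y) l)⁻¹)
      (D.invMetricDeriv x i l) (x i) := by
  have := (D.hasDerivAt_metricCoeff x i l).fun_inv
    (by rw [Function.update_eq_self]; exact (D.metricCoeff_pos hx l).ne')
  rwa [Function.update_eq_self] at this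

theorem eventually_regular_update (D : LiouvilleManifold n) {x : Idx n → ℝ} (hx : D.Regular x)
    (i : Idx n) : ∀ᶠ y in nhds (x i), D.Regular (Function.update x i y) := by
  have hc : ContinuousAt (fun y => Function.update x i y) (x i) :=
    (continuous_const.update i continuous_id).continuousAt
  exact hc.eventually (D.isOpen_regular.mem_nhds (by
    change D.Regular (Function.update x i (x i))
    rwa [Function.update_eq_self]))

/-- This is the `x_i`-derivative of `sum_theta_div_metricCoeff`; among the values `Θ(f_l)` only that
with `l = i` varies. -/
theorem sum_theta_invMetricDeriv (D : LiouvilleManifold n) (b : ℕ → ℝ) {x : Idx n → ℝ}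
    (hx : D.Regular x) (i : Idx n) :
    ∑ l : Idx n, (-1) ^ (l : ℕ) * (thetaPoly n b).eval (D.f l (x l)) * D.invMetricDeriv x i l =
      -((-1) ^ (i : ℕ) * (derivative (thetaPoly n b)).eval (D.f i (x i)) * deriv (D.f i) (x i) /
        D.metricCoeff x i) := by
  have hi := Finset.mem_Icc.1 i.2
  have h1 : HasDerivAt (fun y => ∑ l : Idx n, (-1) ^ (l : ℕ) *
      (thetaPoly n b).eval (D.f l (Function.update x i y l)) *
        (D.metricCoeff (Function.update x i y) l)⁻¹)
      (∑ l : Idx n, ((-1) ^ (l : ℕ) * ((derivative (thetaPoly n b)).eval (D.f l (x l)) *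
        (if l = i then deriv (D.f i) (x i) else 0)) * (D.metricCoeff x l)⁻¹ +
        (-1) ^ (l : ℕ) * (thetaPoly n b).eval (D.f l (x l)) * D.invMetricDeriv x i l)) (x i) := by
    refine HasDerivAt.fun_sum fun l _ => ?_
    have h2 := ((thetaPoly n b).hasDerivAt (D.f l (Function.update x i (x i) l))).comp (x i)
      (D.hasDerivAt_f_update x i l)
    have h3 := (h2.const_mul ((-1) ^ (l : ℕ))).fun_mul (D.hasDerivAt_inv_metricCoeff hx i l)
    simp only [Function.update_eq_self, Function.comp_apply] at h3
    exact h3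
  have h2 : HasDerivAt (fun y => ∑ l : Idx n, (-1) ^ (l : ℕ) *
      (thetaPoly n b).eval (D.f l (Function.update x i y l)) *
        (D.metricCoeff (Function.update x i y) l)⁻¹) 0 (x i) := by
    refine (hasDerivAt_const (x i) (1 : ℝ)).congr_of_eventuallyEq ?_
    filter_upwards [D.eventually_regular_update hx i] with y hy
    simpa only [div_eq_mul_inv] using D.sum_theta_div_metricCoeff (by omega) b hy
  have h3 := h1.unique h2
  rw [Finset.sum_add_distrib] at h3
  rw [Finset.sum_eq_single i (fun l _ hl => by rw [if_neg hl]; ring)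
    (fun h => absurd (Finset.mem_univ i) h), if_pos rfl] at h3
  rw [div_eq_mul_inv]
  linear_combination h3

/-- Splitting `ξ_l²` into its predicted value and the defect makes the coupling between coordinates
linear in the defects. What remains is a function of `x_i` divided by `g_i`. -/
theorem deriv_energy_left (D : LiouvilleManifold n) (b : ℕ → ℝ) {x : Idx n → ℝ}
    (hx : D.Regular x) (ξ : Idx n → ℝ) (i : Idx n) :
    deriv (fun y => D.energy (Function.update x i y) ξ) (x i) =
      1 / 2 * ∑ l, D.invMetricDeriv x i l * D.defect b x ξ l -
        1 / 2 * ((-1) ^ (i : ℕ) * (derivative (thetaPoly n b)).eval (D.f i (x i)) *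
          deriv (D.f i) (x i) / D.metricCoeff x i) := by
  have h1 : HasDerivAt (fun y => D.energy (Function.update x i y) ξ)
      (1 / 2 * ∑ l, ξ l ^ 2 * D.invMetricDeriv x i l) (x i) := by
    have := HasDerivAt.fun_sum (u := Finset.univ) fun l _ =>
      (D.hasDerivAt_inv_metricCoeff hx i l).const_mul (ξ l ^ 2)
    exact this.const_mul (1 / 2)
  have h2 := D.sum_theta_invMetricDeriv b hx i
  have h3 : ∑ l, D.invMetricDeriv x i l * D.defect b x ξ l =
      ∑ l, ξ l ^ 2 * D.invMetricDeriv x i l -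
      ∑ l : Idx n, (-1) ^ (l : ℕ) * (thetaPoly n b).eval (D.f l (x l)) * D.invMetricDeriv x i l := by
    rw [← Finset.sum_sub_distrib]
    exact Finset.sum_congr rfl fun l _ => by rw [defect]; ring
  rw [h1.deriv, h3, h2]
  ring

theorem deriv_energy_right (D : LiouvilleManifold n) (x ξ : Idx n → ℝ) (i : Idx n) :
    deriv (fun y => D.energy x (Function.update ξ i y)) (ξ i) = ξ i / D.metricCoeff x i := by
  have h0 : ∀ l : Idx n, HasDerivAt (fun y => Function.update ξ i y l ^ 2)
      (if l = i then 2 * ξ i else 0) (ξ i) := by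
    intro l
    split_ifs with h
    · subst h
      simpa using (hasDerivAt_id (ξ l)).fun_pow 2
    · simpa [Function.update_of_ne h] using hasDerivAt_const (ξ i) (ξ l ^ 2)
  have h1 := (HasDerivAt.fun_sum (u := Finset.univ) fun l _ =>
    (h0 l).div_const (D.metricCoeff x l)).const_mul (1 / 2)
  have h2 : HasDerivAt (fun y => D.energy x (Function.update ξ i y)) _ (ξ i) := h1
  rw [h2.deriv, Finset.sum_eq_single i (fun l _ hl => by rw [if_neg hl, zero_div])
    (fun h => absurd (Finset.mem_univ i) h), if_pos rfl]
  ring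

end LiouvilleManifold

/-! ### Phases and the total variation of a cosine -/

/-- A solution of the harmonic oscillator in disguise: a curve on the unit circle, whose velocity is
tangential and which does not rest at the poles, is parametrized by a phase. -/
theorem exists_phase {c s ρ s' : ℝ → ℝ} (hcs : ∀ t, c t ^ 2 + s t ^ 2 = 1)
    (hc : ∀ t, HasDerivAt c (ρ t * s t) t) (hs : ∀ t, HasDerivAt s (s' t) t)
    (hs0 : ∀ t, s t = 0 → s' t ≠ 0) (hρ : Continuous ρ) :
    ∃ φ : ℝ → ℝ, (∀ t, HasDerivAt φ (ρ t) t) ∧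
      ∀ t, c t = Real.cos (φ t) ∧ s t = -Real.sin (φ t) := by
  have hcc : Continuous c := continuous_iff_continuousAt.2 fun t => (hc t).continuousAt
  have hgen : ∀ t, s t ≠ 0 → s' t = -(ρ t * c t) := by
    intro t ht
    have h1 := ((hc t).fun_pow 2).fun_add ((hs t).fun_pow 2)
    have h2 := h1.unique ((hasDerivAt_const t (1 : ℝ)).congr_of_eventuallyEq
      (Filter.Eventually.of_forall hcs))
    norm_num at h2
    have h3 : s t * (s' t + ρ t * c t) = 0 := by linear_combination h2 / 2
    have h4 := (mul_eq_zero.1 h3).resolve_left ht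
    linarith
  have hall : ∀ t, s' t = -(ρ t * c t) := by
    intro t
    by_cases ht : s t = 0
    · have hne : ∀ᶠ z in nhdsWithin t (Set.Ioi t), s z ≠ 0 :=
        ((hs t).eventually_ne (c := 0) (hs0 t ht)).filter_mono
          (nhdsWithin_mono t fun z hz => ne_of_gt hz)
      have hlim : Filter.Tendsto (deriv s) (nhdsWithin t (Set.Ioi t))
          (nhds (-(ρ t * c t))) := by
        have h1 : Filter.Tendsto (fun z => -(ρ z * c z)) (nhdsWithin t (Set.Ioi t))
            (nhds (-(ρ t * c t))) :=
          ((hρ.mul hcc).neg.tendsto t).mono_left nhdsWithin_le_nhds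
        refine h1.congr' ?_
        filter_upwards [hne] with z hz
        rw [(hs z).deriv, hgen z hz]
      have h2 := hasDerivWithinAt_Ici_of_tendsto_deriv (s := Set.univ)
        (fun z _ => (hs z).differentiableAt.differentiableWithinAt)
        (hs t).continuousAt.continuousWithinAt Filter.univ_mem hlim
      exact (uniqueDiffWithinAt_Ici t).eq_deriv _ (hs t).hasDerivWithinAt h2
    · exact hgen t ht
  obtain ⟨φ₀, hφ₀, hφ₀'⟩ : ∃ φ₀, c 0 = Real.cos φ₀ ∧ s 0 = -Real.sin φ₀ := by
    have h := hcs 0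
    have h1 : -1 ≤ c 0 := by nlinarith [sq_nonneg (s 0)]
    have h2 : c 0 ≤ 1 := by nlinarith [sq_nonneg (s 0)]
    have h3 : √(1 - c 0 ^ 2) = |s 0| := by rw [← Real.sqrt_sq_eq_abs]; congr 1; linarith
    rcases abs_choice (s 0) with h4 | h4
    · exact ⟨-Real.arccos (c 0), by rw [Real.cos_neg, Real.cos_arccos h1 h2],
        by rw [Real.sin_neg, Real.sin_arccos, h3, h4, neg_neg]⟩
    · exact ⟨Real.arccos (c 0), (Real.cos_arccos h1 h2).symm,
        by rw [Real.sin_arccos, h3, h4, neg_neg]⟩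
  refine ⟨fun t => φ₀ + ∫ u in (0 : ℝ)..t, ρ u, fun t => ?_, ?_⟩
  · exact (hρ.integral_hasStrictDerivAt 0 t).hasDerivAt.const_add _
  set φ : ℝ → ℝ := fun t => φ₀ + ∫ u in (0 : ℝ)..t, ρ u with hφ
  have hφd : ∀ t, HasDerivAt φ (ρ t) t := fun t =>
    (hρ.integral_hasStrictDerivAt 0 t).hasDerivAt.const_add _
  -- Both curves solve the same linear system, a rotation with speed `ρ`, so their squared distance
  -- is constant.
  have hw : ∀ t, HasDerivAt
      (fun t => (c t - Real.cos (φ t)) ^ 2 + (s t + Real.sin (φ t)) ^ 2) 0 t := by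
    intro t
    have h1 := (((hc t).fun_sub (hφd t).cos).fun_pow 2).fun_add
      (((hs t).fun_add (hφd t).sin).fun_pow 2)
    refine h1.congr_deriv ?_
    rw [hall t]
    norm_num
    ring
  have hconst := is_const_of_deriv_eq_zero (fun t => (hw t).differentiableAt)
    (fun t => (hw t).deriv)
  intro t
  have h1 := hconst t 0
  have h2 : φ 0 = φ₀ := by simp [hφ]
  rw [h2, hφ₀, hφ₀'] at h1
  have h3 : (c t - Real.cos (φ t)) ^ 2 + (s t + Real.sin (φ t)) ^ 2 = 0 := by
    rw [h1]; ring
  have h4 := sq_nonneg (c t - Real.cos (φ t))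
  have h5 := sq_nonneg (s t + Real.sin (φ t))
  have h6 : (c t - Real.cos (φ t)) ^ 2 = 0 := by linarith
  have h7 : (s t + Real.sin (φ t)) ^ 2 = 0 := by linarith
  constructor
  · linarith [pow_eq_zero_iff two_ne_zero |>.1 h6]
  · linarith [pow_eq_zero_iff two_ne_zero |>.1 h7]

theorem integral_abs_sin_pos {a b : ℝ} (hab : a < b) : 0 < ∫ θ in a..b, |Real.sin θ| := by
  refine intervalIntegral.integral_pos hab Real.continuous_sin.abs.continuousOn
    (fun _ _ => abs_nonneg _) ?_
  by_cases h : Real.sin a = 0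
  · have hδ : 0 < min (b - a) 1 := lt_min (by linarith) one_pos
    refine ⟨a + min (b - a) 1, ⟨by linarith, by linarith [min_le_left (b - a) 1]⟩, ?_⟩
    have h1 : 0 < Real.sin (min (b - a) 1) :=
      Real.sin_pos_of_pos_of_lt_pi hδ (by linarith [min_le_right (b - a) 1, Real.pi_gt_three])
    have h2 : Real.cos a ≠ 0 := fun h2 => by
      have := Real.sin_sq_add_cos_sq a
      rw [h, h2] at this
      norm_num at this
    rw [Real.sin_add, h, zero_mul, zero_add]
    exact abs_pos.2 (mul_ne_zero h2 h1.ne')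
  · exact ⟨a, ⟨le_rfl, hab.le⟩, abs_pos.2 h⟩

theorem integral_abs_sin_period (t : ℝ) : ∫ θ in t..(t + 2 * Real.pi), |Real.sin θ| = 4 := by
  have hper : Function.Periodic (fun θ => |Real.sin θ|) Real.pi := fun θ => by
    simp [Real.sin_add_pi]
  have h0 : ∫ θ in (0 : ℝ)..Real.pi, |Real.sin θ| = 2 := by
    have h : ∫ θ in (0 : ℝ)..Real.pi, |Real.sin θ| = ∫ θ in (0 : ℝ)..Real.pi, Real.sin θ := by
      refine intervalIntegral.integral_congr fun θ hθ => abs_of_nonneg ?_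
      rw [Set.uIcc_of_le Real.pi_pos.le] at hθ
      exact Real.sin_nonneg_of_mem_Icc hθ
    rw [h, integral_sin, Real.cos_zero, Real.cos_pi]
    norm_num
  have h1 : ∀ u, ∫ θ in u..(u + Real.pi), |Real.sin θ| = 2 := fun u => by
    rw [hper.intervalIntegral_add_eq u 0, zero_add, h0]
  have h2 := intervalIntegral.integral_add_adjacent_intervals
    (Real.continuous_sin.abs.intervalIntegrable (μ := MeasureTheory.volume) t (t + Real.pi))
    (Real.continuous_sin.abs.intervalIntegrable (t + Real.pi) (t + Real.pi + Real.pi))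
  rw [h1, h1] at h2
  rw [show t + 2 * Real.pi = t + Real.pi + Real.pi by ring, ← h2]
  norm_num

/-- A phase is determined by the total variation of its cosine. -/
theorem eq_add_two_pi_of_integral_abs_sin {u v : ℝ} (h : ∫ θ in u..v, |Real.sin θ| = 4) :
    v = u + 2 * Real.pi := by
  have hint : ∀ a b, IntervalIntegrable (fun θ => |Real.sin θ|) MeasureTheory.volume a b :=
    fun a b => Real.continuous_sin.abs.intervalIntegrable a b
  have h1 := intervalIntegral.integral_add_adjacent_intervals (hint u v) (hint v (u + 2 * Real.pi))
  rw [integral_abs_sin_period, h] at h1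
  rcases lt_trichotomy v (u + 2 * Real.pi) with hlt | heq | hlt
  · linarith [integral_abs_sin_pos hlt]
  · exact heq
  · rw [intervalIntegral.integral_symm] at h1
    linarith [integral_abs_sin_pos hlt]

/-! ### Conservation of the constants along the geodesic -/

namespace LiouvilleManifold

open Polynomial

variable {n : ℕ}

section Flow

variable {D : LiouvilleManifold n} {γ : ℝ → D.Space} {x ξ : ℝ → Idx n → ℝ} {b : ℕ → ℝ}

theorem IsGeodesicLift.hasDerivAt_x (h : D.IsGeodesicLift γ x ξ) {t : ℝ} (ht : D.Regular (x t))
    (i : Idx n) : HasDerivAt (fun s => x s i) (ξ t i / D.metricCoeff (x t) i) t := by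
  have := h.hamilton_x t ht i
  rwa [deriv_energy_right] at this

theorem IsGeodesicLift.hasDerivAt_ξ (h : D.IsGeodesicLift γ x ξ) (b : ℕ → ℝ) {t : ℝ}
    (ht : D.Regular (x t)) (i : Idx n) : HasDerivAt (fun s => ξ s i)
      (-(1 / 2 * ∑ l, D.invMetricDeriv (x t) i l * D.defect b (x t) (ξ t) l -
        1 / 2 * ((-1) ^ (i : ℕ) * (derivative (thetaPoly n b)).eval (D.f i (x t i)) *
          deriv (D.f i) (x t i) / D.metricCoeff (x t) i))) t := by
  have := h.hamilton_ξ t ht i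
  rwa [deriv_energy_left D b ht] at this

theorem IsGeodesicLift.hasDerivAt_f (h : D.IsGeodesicLift γ x ξ) {t : ℝ} (ht : D.Regular (x t))
    (i : Idx n) : HasDerivAt (fun s => D.f i (x s i))
      (deriv (D.f i) (x t i) * (ξ t i / D.metricCoeff (x t) i)) t :=
  (D.f_differentiable i (x t i)).hasDerivAt.comp t (h.hasDerivAt_x ht i)

/-- The defects satisfy a linear differential equation. -/
theorem IsGeodesicLift.hasDerivAt_defect (h : D.IsGeodesicLift γ x ξ) (b : ℕ → ℝ) {t : ℝ}
    (ht : D.Regular (x t)) (i : Idx n) : HasDerivAt (fun s => D.defect b (x s) (ξ s) i)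
      (∑ l, (-ξ t i * D.invMetricDeriv (x t) i l) * D.defect b (x t) (ξ t) l) t := by
  have h1 := ((thetaPoly n b).hasDerivAt (D.f i (x t i))).comp t (h.hasDerivAt_f ht i)
  have h2 := ((h.hasDerivAt_ξ b ht i).fun_pow 2).fun_sub (h1.const_mul ((-1) ^ (i : ℕ)))
  -- The `Θ'` terms from `ξ_i²` and from `Θ(f_i)` cancel, leaving an expression linear in the
  -- defects.
  refine h2.congr_deriv ?_
  simp only [mul_assoc]
  rw [← Finset.mul_sum]
  norm_num
  ring

theorem IsGeodesicLift.eventually_regular (h : D.IsGeodesicLift γ x ξ) {t : ℝ}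
    (ht : D.Regular (x t)) : ∀ᶠ s in nhds t, D.Regular (x s) :=
  h.continuous.continuousAt.eventually (D.isOpen_regular.mem_nhds ht)

theorem lipschitz_matrix {ι : Type*} [Fintype ι] (M : ι → ι → ℝ) {C : NNReal}
    (hM : ∀ i l, |M i l| ≤ C) :
    LipschitzWith (Fintype.card ι * C) fun (u : ι → ℝ) i => ∑ l, M i l * u l := by
  refine LipschitzWith.of_dist_le_mul fun u v => ?_
  refine (dist_pi_le_iff (by positivity)).2 fun i => ?_
  rw [Real.dist_eq, ← Finset.sum_sub_distrib]
  refine (Finset.abs_sum_le_sum_abs _ _).trans ?_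
  have : ∀ l ∈ Finset.univ, |M i l * u l - M i l * v l| ≤ C * dist u v := fun l _ => by
    rw [← mul_sub, abs_mul, ← Real.dist_eq]
    exact mul_le_mul (hM i l) (dist_le_pi_dist u v l) dist_nonneg C.2
  refine (Finset.sum_le_card_nsmul _ _ _ this).trans_eq ?_
  rw [nsmul_eq_mul, Finset.card_univ]
  push_cast
  ring

/-- Zero solves the same linear system, whose coefficients are bounded near `t₀`, so local
uniqueness applies. -/
theorem IsGeodesicLift.eventually_defect_eq_zero (h : D.IsGeodesicLift γ x ξ) {t₀ : ℝ}
    (ht₀ : D.Regular (x t₀)) (h₀ : ∀ i, D.defect b (x t₀) (ξ t₀) i = 0) :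
    ∀ᶠ t in nhds t₀, ∀ i, D.defect b (x t) (ξ t) i = 0 := by
  set M : ℝ → Idx n → Idx n → ℝ := fun t i l => -ξ t i * D.invMetricDeriv (x t) i l with hM
  have hMc : ∀ i l, ContinuousAt (fun t => M t i l) t₀ := by
    intro i l
    have h1 : ContinuousAt (fun t => ξ t i) t₀ := (h.hasDerivAt_ξ b ht₀ i).continuousAt
    have h2 : Continuous fun t => D.metricCoeffDeriv (x t) i l :=
      (D.continuous_metricCoeffDeriv i l).comp h.continuous
    have h3 : Continuous fun t => D.metricCoeff (x t) l :=
      (D.continuous_metricCoeff l).comp h.continuous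
    exact h1.neg.mul (h2.continuousAt.neg.div (h3.continuousAt.pow 2)
      (pow_ne_zero 2 (D.metricCoeff_pos ht₀ l).ne'))
  set C : NNReal := ∑ i, ∑ l, ‖M t₀ i l‖₊ + 1 with hC
  have hbound : ∀ i l, |M t₀ i l| < C := by
    intro i l
    have h1 : ‖M t₀ i l‖₊ ≤ ∑ i, ∑ l, ‖M t₀ i l‖₊ :=
      (Finset.single_le_sum (f := fun l => ‖M t₀ i l‖₊) (fun _ _ => zero_le)
        (Finset.mem_univ l)).trans
      (Finset.single_le_sum (f := fun i => ∑ l, ‖M t₀ i l‖₊) (fun _ _ => zero_le)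
        (Finset.mem_univ i))
    have h2 : ‖M t₀ i l‖₊ < C := h1.trans_lt (by rw [hC]; exact lt_add_one _)
    rw [← Real.norm_eq_abs, ← coe_nnnorm]
    exact_mod_cast h2
  have hev : ∀ᶠ t in nhds t₀, ∀ i l, |M t i l| < C := by
    refine Filter.eventually_all.2 fun i => Filter.eventually_all.2 fun l => ?_
    exact (hMc i l).abs.eventually (gt_mem_nhds (hbound i l))
  have huniq := ODE_solution_unique_of_eventually (t₀ := t₀)
    (v := fun t (u : Idx n → ℝ) i => ∑ l, M t i l * u l) (s := fun _ => Set.univ)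
    (K := Fintype.card (Idx n) * C) (f := fun t i => D.defect b (x t) (ξ t) i) (g := fun _ _ => 0)
    ?_ ?_ ?_ (funext h₀)
  · filter_upwards [huniq] with t ht i
    exact congrFun ht i
  · filter_upwards [hev] with t ht
    exact (lipschitz_matrix (M t) fun i l => (ht i l).le).lipschitzOnWith
  · filter_upwards [h.eventually_regular ht₀] with t ht
    exact ⟨hasDerivAt_pi.2 fun i => h.hasDerivAt_defect b ht i, Set.mem_univ _⟩
  · refine Filter.Eventually.of_forall fun t => ⟨?_, Set.mem_univ _⟩
    have : (fun i => ∑ l, M t i l * (fun _ : Idx n => (0 : ℝ)) l) = 0 := by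
      funext i; simp
    rw [this]
    exact hasDerivAt_const t (0 : Idx n → ℝ)

theorem f_mem_of_defect_eq_zero (hb : ∀ i, 1 ≤ i → i + 1 ≤ n - 1 → b (i + 1) ≤ b i)
    {x ξ : Idx n → ℝ} (hx : D.Regular x) (h₀ : ∀ i, D.defect b x ξ i = 0) (i : Idx n) :
    D.f i (x i) ∈ Set.Icc (D.lower b i) (D.upper b i) := by
  refine D.f_mem_of_interlace hb hx (fun i => ?_) i
  rw [← sub_eq_zero.1 (h₀ i)]
  exact sq_nonneg _

/-- A geodesic whose constants are distinct never meets the branch locus, and its constants are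
conserved. -/
theorem IsGeodesicLift.conserved (h : D.IsGeodesicLift γ x ξ) (hd : D.DistinctConstants b)
    (hb : ∀ i, 1 ≤ i → i + 1 ≤ n - 1 → b (i + 1) ≤ b i) (hx : D.Regular (x 0))
    (h₀ : ∀ i, D.defect b (x 0) (ξ 0) i = 0) (t : ℝ) :
    D.Regular (x t) ∧ ∀ i, D.defect b (x t) (ξ t) i = 0 := by
  set Z : Set ℝ := {t | ∀ i : Idx n, D.f i (x t i) ∈ Set.Icc (D.lower b i) (D.upper b i)} with hZ
  have hZc : IsClosed Z := by
    rw [hZ, Set.ofPred_forall]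
    refine isClosed_iInter fun i => isClosed_Icc.preimage ?_
    exact (D.f_differentiable i).continuous.comp ((continuous_apply i).comp h.continuous)
  have hreg : ∀ t ∈ Z, D.Regular (x t) := fun t ht => D.regular_of_mem hd ht
  have hcont : ContinuousOn (fun t i => D.defect b (x t) (ξ t) i) Z :=
    continuousOn_pi.2 fun i t ht =>
      (h.hasDerivAt_defect b (hreg t ht) i).continuousAt.continuousWithinAt
  -- Closed, because the defects are continuous on the closed set `Z`, where all points are regular.
  -- Open, because regularity and vanishing of the defects persist locally, and together they put
  -- the values back into the intervals.
  have hclopen : IsClopen (Z ∩ (fun t i => D.defect b (x t) (ξ t) i) ⁻¹' {0}) := by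
    refine ⟨hcont.preimage_isClosed_of_isClosed hZc isClosed_singleton,
      isOpen_iff_mem_nhds.2 fun t ht => ?_⟩
    have hr := hreg t ht.1
    filter_upwards [h.eventually_regular hr,
      h.eventually_defect_eq_zero (b := b) hr (congrFun ht.2)] with s hs hs'
    exact ⟨fun i => f_mem_of_defect_eq_zero hb hs hs' i, funext hs'⟩
  have huniv := hclopen.eq_univ ⟨0, fun i => f_mem_of_defect_eq_zero hb hx h₀ i, funext h₀⟩
  have ht : t ∈ Z ∩ (fun t i => D.defect b (x t) (ξ t) i) ⁻¹' {0} := huniv ▸ Set.mem_univ t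
  exact ⟨hreg t ht.1, congrFun ht.2⟩

end Flow

end LiouvilleManifold

/-! ### The phases of the coordinates -/

theorem prod_Icc_eq_prod_range_succ (g : ℕ → ℝ) (m : ℕ) :
    ∏ k ∈ Finset.Icc 1 m, g k = ∏ k ∈ Finset.range m, g (k + 1) := by
  have : Finset.Icc 1 m = Finset.Ico (0 + 1) (m + 1) := by
    ext k; simp only [Finset.mem_Icc, Finset.mem_Ico]; omega
  rw [this, ← Finset.prod_Ico_add', Finset.range_eq_Ico]

theorem sub_max_mul_sub_min (r u v : ℝ) : (r - max u v) * (r - min u v) = (r - u) * (r - v) := by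
  rcases le_total u v with h | h
  · rw [max_eq_right h, min_eq_left h, mul_comm]
  · rw [max_eq_left h, min_eq_right h]

namespace LiouvilleManifold

open Polynomial

variable {n : ℕ}

/-- The ends of the ranges of the `f_i(x_i)` are the constants `a_j` and `b_k`. -/
theorem prod_lower_upper (D : LiouvilleManifold n) (hn : 1 ≤ n) (b : ℕ → ℝ) (r : ℝ) :
    ∏ l : Idx n, (r - D.lower b l) * (r - D.upper b l) =
      (∏ j ∈ Finset.range (n + 1), (r - D.a j)) * ∏ k ∈ Finset.Icc 1 (n - 1), (r - b k) := by
  obtain ⟨m, rfl⟩ := Nat.exists_eq_add_of_le' hn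
  have h1 : ∏ l : Idx (m + 1), (r - D.lower b l) * (r - D.upper b l) =
      ∏ k ∈ Finset.Icc 1 (m + 1), (r - D.aPlus b k) * (r - D.aMinus b (k - 1)) :=
    Finset.prod_coe_sort (Finset.Icc 1 (m + 1))
      fun k => (r - D.aPlus b k) * (r - D.aMinus b (k - 1))
  have hP : ∀ k ∈ Finset.range m, r - D.aPlus b (k + 1) = r - max (D.a (k + 1)) (b (k + 1)) :=
    fun k hk => by
      have := Finset.mem_range.1 hk
      rw [aPlus, if_neg (by omega)]
  have hM : ∀ k ∈ Finset.range m, r - D.aMinus b (k + 1) = r - min (D.a (k + 1)) (b (k + 1)) :=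
    fun k _ => by rw [aMinus, if_neg (by omega)]
  rw [h1, prod_Icc_eq_prod_range_succ, Finset.prod_mul_distrib, Nat.add_sub_cancel,
    prod_Icc_eq_prod_range_succ]
  simp only [Nat.add_sub_cancel]
  rw [Finset.prod_range_succ, Finset.prod_range_succ' (fun k => r - D.aMinus b k),
    Finset.prod_congr rfl hP, Finset.prod_congr rfl hM, Finset.prod_range_succ,
    Finset.prod_range_succ' (fun k => r - D.a k)]
  have h2 : (∏ k ∈ Finset.range m, (r - max (D.a (k + 1)) (b (k + 1)))) *
      ∏ k ∈ Finset.range m, (r - min (D.a (k + 1)) (b (k + 1))) =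
      (∏ k ∈ Finset.range m, (r - D.a (k + 1))) * ∏ k ∈ Finset.range m, (r - b (k + 1)) := by
    rw [← Finset.prod_mul_distrib, ← Finset.prod_mul_distrib]
    exact Finset.prod_congr rfl fun k _ => sub_max_mul_sub_min _ _ _
  have h3 : D.aPlus b (m + 1) = D.a (m + 1) := by rw [aPlus, if_pos rfl]
  have h4 : D.aMinus b 0 = D.a 0 := by rw [aMinus, if_pos rfl]
  rw [h3, h4]
  linear_combination (r - D.a (m + 1)) * (r - D.a 0) * h2

theorem lower_lt_upper (D : LiouvilleManifold n) {b : ℕ → ℝ} (hd : D.DistinctConstants b)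
    {x : Idx n → ℝ} (h : ∀ i : Idx n, D.f i (x i) ∈ Set.Icc (D.lower b i) (D.upper b i))
    (l : Idx n) : D.lower b l < D.upper b l :=
  lt_of_le_of_ne ((h l).1.trans (h l).2) (D.lower_ne_upper hd l)

theorem deriv_theta_ne_zero {b : ℕ → ℝ}
    (hbb : ∀ i ∈ Finset.Icc 1 (n - 1), ∀ j ∈ Finset.Icc 1 (n - 1), i ≠ j → b i ≠ b j)
    {r : ℝ} (hr : (thetaPoly n b).eval r = 0) : (derivative (thetaPoly n b)).eval r ≠ 0 := by
  rw [eval_thetaPoly, neg_eq_zero] at hr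
  obtain ⟨k, hk, hk'⟩ := Finset.prod_eq_zero_iff.1 hr
  rw [sub_eq_zero.1 hk', thetaPoly, derivative_neg, eval_neg, neg_ne_zero,
    Lagrange.eval_nodal_derivative_eval_node_eq hk, Lagrange.eval_nodal]
  exact Finset.prod_ne_zero_iff.2 fun j hj h => hbb k hk j (Finset.mem_of_mem_erase hj)
    (Finset.ne_of_mem_erase hj).symm (sub_eq_zero.1 h)

section Phase

variable {D : LiouvilleManifold n} {γ : ℝ → D.Space} {x ξ : ℝ → Idx n → ℝ} {b : ℕ → ℝ}

/-- The coordinate functions oscillate between their extremal values with a strictly increasing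
phase. -/
theorem IsGeodesicLift.exists_phase (h : D.IsGeodesicLift γ x ξ) (hd : D.DistinctConstants b)
    (hb : ∀ i, 1 ≤ i → i + 1 ≤ n - 1 → b (i + 1) ≤ b i) (hreg : ∀ t, D.Regular (x t))
    (h₀ : ∀ t i, D.defect b (x t) (ξ t) i = 0) (l : Idx n) :
    ∃ φ : ℝ → ℝ,
      (∀ t, HasDerivAt φ (2 * √(gapFactor (D.lower b) (D.upper b) l (D.f l (x t l))) /
        (D.A (D.f l (x t l)) * D.metricCoeff (x t) l)) t) ∧
      ∀ t, D.f l (x t l) = angleParam (D.lower b) (D.upper b) l (φ t) := by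
  have hl := Finset.mem_Icc.1 l.2
  set p := D.lower b with hp
  set q := D.upper b with hq
  set H : ℝ → ℝ := fun t => D.f l (x t l) with hH
  have hmem : ∀ t, ∀ i : Idx n, D.f i (x t i) ∈ Set.Icc (p i) (q i) := fun t i =>
    f_mem_of_defect_eq_zero hb (hreg t) (h₀ t) i
  have hpq : ∀ l, p l < q l := D.lower_lt_upper hd (hmem 0)
  have hsep : ∀ k l, k < l → q l < p k := D.upper_lt_lower hd
  have hg : ∀ t, 0 < D.metricCoeff (x t) l := fun t => D.metricCoeff_pos (hreg t) l
  have hA : ∀ t, 0 < D.A (H t) := fun t => D.A_pos _ (D.f_mem_range l (x t l))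
  have hQ : ∀ t, 0 < gapFactor p q l (H t) := fun t => gap_factor_pos hpq hsep l (hmem t l)
  have hr : 0 < (q l - p l) / 2 := by linarith [hpq l]
  -- `N` is the velocity of `H` times the metric coefficient. The factor `κ` scales it so that the
  -- normalized position and `N * κ` lie on the unit circle and rotate with speed `ρ`.
  set N : ℝ → ℝ := fun t => deriv (D.f l) (x t l) * ξ t l with hN
  set κ : ℝ → ℝ := fun t => D.A (H t) / (2 * ((q l - p l) / 2) * √(gapFactor p q l (H t))) with hκ
  set ρ : ℝ → ℝ := fun t => 2 * √(gapFactor p q l (H t)) / (D.A (H t) * D.metricCoeff (x t) l)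
    with hρ
  have hHd : ∀ t, HasDerivAt H (N t / D.metricCoeff (x t) l) t := fun t =>
    (h.hasDerivAt_f (hreg t) l).congr_deriv (by simp only [hN]; ring)
  have hAd : ∀ t, DifferentiableAt ℝ (fun t => D.A (H t)) t := fun t =>
    ((D.hasDerivWithinAt_A (D.f_mem_range l (x t l))).comp_hasDerivAt t (hHd t)
      (Filter.Eventually.of_forall fun s => D.f_mem_range l (x s l))).differentiableAt
  have hQd : ∀ t, DifferentiableAt ℝ (fun t => √(gapFactor p q l (H t))) t := fun t => by
    have h1 : Differentiable ℝ (gapFactor p q l) := by unfold gapFactor; fun_prop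
    exact ((h1 (H t)).comp t (hHd t).differentiableAt).sqrt (hQ t).ne'
  have hsQ : ∀ t, 0 < √(gapFactor p q l (H t)) := fun t => Real.sqrt_pos.2 (hQ t)
  have hκd : ∀ t, DifferentiableAt ℝ κ t := fun t =>
    (hAd t).fun_div ((hQd t).const_mul _) (by have := hsQ t; positivity)
  have hκ0 : ∀ t, κ t ≠ 0 := fun t => by
    have h1 := hsQ t
    have h2 := hA t
    simp only [hκ]
    positivity
  have hddf : Differentiable ℝ (deriv (D.f l)) :=
    ((contDiff_infty_iff_deriv.1 (D.f_smooth l l.2)).2).differentiable (by simp)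
  set N' : ℝ → ℝ := fun t =>
    deriv (deriv (D.f l)) (x t l) * (ξ t l / D.metricCoeff (x t) l) * ξ t l +
      deriv (D.f l) (x t l) * (1 / 2 * ((-1) ^ (l : ℕ) *
        (derivative (thetaPoly n b)).eval (H t) * deriv (D.f l) (x t l) /
          D.metricCoeff (x t) l)) with hN'
  have hNd : ∀ t, HasDerivAt N (N' t) t := by
    intro t
    have h1 : HasDerivAt (fun t => deriv (D.f l) (x t l))
        (deriv (deriv (D.f l)) (x t l) * (ξ t l / D.metricCoeff (x t) l)) t :=
      HasDerivAt.comp (h := fun s => x s l) (h₂ := deriv (D.f l)) t (hddf (x t l)).hasDerivAt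
        (h.hasDerivAt_x (hreg t) l)
    refine (h1.fun_mul (h.hasDerivAt_ξ b (hreg t) l)).congr_deriv ?_
    simp only [h₀ t, mul_zero, Finset.sum_const_zero, zero_sub, neg_neg, hN', hH]
  have hξ : ∀ t, ξ t l ^ 2 = (-1) ^ (l : ℕ) * (thetaPoly n b).eval (H t) := fun t =>
    sub_eq_zero.1 (h₀ t l)
  have hLtheta : ∀ t, deriv (D.f l) (x t l) = 0 → (thetaPoly n b).eval (H t) ≠ 0 := by
    intro t ht hθ
    have h1 := D.deriv_f_sq_mul l (x t l)
    rw [ht, zero_pow two_ne_zero, zero_mul] at h1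
    have h2 : (-1 : ℝ) ^ (l : ℕ) * 4 ≠ 0 := by simp
    obtain ⟨j, hj, hj'⟩ := Finset.prod_eq_zero_iff.1 ((mul_eq_zero.1 h1.symm).resolve_left h2)
    rw [eval_thetaPoly, neg_eq_zero] at hθ
    obtain ⟨k, hk, hk'⟩ := Finset.prod_eq_zero_iff.1 hθ
    exact hd.ba k hk j hj ((sub_eq_zero.1 hk').symm.trans (sub_eq_zero.1 hj'))
  -- This excludes rest at a turning point. Exactly one of `f_l'` and `ξ_l` vanishes there, since no
  -- `b k` is an `a j`, and its zero is simple: by nondegeneracy of the critical points of `f_l`, or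
  -- by simplicity of the zeros of `Θ`.
  have hN0 : ∀ t, N t = 0 → N' t ≠ 0 := by
    intro t ht
    have hgt := (hg t).ne'
    rcases mul_eq_zero.1 ht with hf0 | hξ0
    · have h1 := D.deriv_deriv_f_ne_zero l hf0
      have h2 : ξ t l ≠ 0 := fun h2 => by
        have h3 := hξ t
        rw [h2, zero_pow two_ne_zero] at h3
        exact hLtheta t hf0 ((mul_eq_zero.1 h3.symm).resolve_left (by simp))
      simp only [hN', hf0, zero_mul, add_zero]
      exact mul_ne_zero (mul_ne_zero h1 (div_ne_zero h2 hgt)) h2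
    · have h3 := hξ t
      rw [hξ0, zero_pow two_ne_zero] at h3
      have h4 : (thetaPoly n b).eval (H t) = 0 := (mul_eq_zero.1 h3.symm).resolve_left (by simp)
      have h5 : deriv (D.f l) (x t l) ≠ 0 := fun h5 => hLtheta t h5 h4
      have h6 := deriv_theta_ne_zero hd.bb h4
      have h7 : ((-1 : ℝ) ^ (l : ℕ)) ≠ 0 := by simp
      simp only [hN', hξ0, mul_zero, zero_add]
      exact mul_ne_zero h5 (mul_ne_zero (by norm_num)
        (div_ne_zero (mul_ne_zero (mul_ne_zero h7 h6) h5) hgt))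
  -- The equation for `f_l` brings the factors `H - a j` and the separated momentum the factors `H -
  -- b k`. By `prod_lower_upper` they regroup into interval ends.
  have hNsq : ∀ t, N t ^ 2 * D.A (H t) ^ 2 =
      4 * ((H t - p l) * (q l - H t) * gapFactor p q l (H t)) := by
    intro t
    have h1 := D.deriv_f_sq_mul l (x t l)
    have h2 := D.prod_lower_upper (by omega) b (H t)
    rw [← Finset.mul_prod_erase _ _ (Finset.mem_univ l)] at h2
    have h3 := hξ t
    rw [eval_thetaPoly] at h3
    have h4 : (-1 : ℝ) ^ (l : ℕ) * (-1) ^ (l : ℕ) = 1 := by rw [← mul_pow]; simp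
    calc N t ^ 2 * D.A (H t) ^ 2
        = (deriv (D.f l) (x t l) ^ 2 * D.A (D.f l (x t l)) ^ 2) * ξ t l ^ 2 := by
          simp only [hN, hH]; ring
      _ = -4 * ((-1 : ℝ) ^ (l : ℕ) * (-1) ^ (l : ℕ)) *
          ((∏ j ∈ Finset.range (n + 1), (H t - D.a j)) *
            ∏ k ∈ Finset.Icc 1 (n - 1), (H t - b k)) := by rw [h1, h3]; ring
      _ = 4 * ((H t - p l) * (q l - H t) * gapFactor p q l (H t)) := by
          rw [h4, ← h2, gapFactor]; ring
  have hcs : ∀ t, ((H t - (p l + q l) / 2) / ((q l - p l) / 2)) ^ 2 + (N t * κ t) ^ 2 = 1 := by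
    intro t
    have h1 := Real.sq_sqrt (hQ t).le
    have h2 := (hsQ t).ne'
    have h3 : (N t * κ t) ^ 2 = (H t - p l) * (q l - H t) / ((q l - p l) / 2) ^ 2 := by
      simp only [hκ]
      rw [mul_pow, div_pow, ← mul_div_assoc, hNsq, mul_pow, h1]
      have := (hQ t).ne'
      field_simp
      ring
    rw [h3, div_pow, ← add_div, div_eq_one_iff_eq (pow_ne_zero 2 hr.ne')]
    ring
  have hc : ∀ t, HasDerivAt (fun t => (H t - (p l + q l) / 2) / ((q l - p l) / 2))
      (ρ t * (N t * κ t)) t := by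
    intro t
    refine (((hHd t).sub_const _).div_const _).congr_deriv ?_
    have h1 := (hsQ t).ne'
    have h2 := (hA t).ne'
    have h3 := (hg t).ne'
    have h4 : q l - p l ≠ 0 := by linarith
    simp only [hρ, hκ]
    field_simp
  have hρc : Continuous ρ := by
    have c1 : Continuous fun t => D.A (H t) :=
      continuous_iff_continuousAt.2 fun t => (hAd t).continuousAt
    have c2 : Continuous fun t => √(gapFactor p q l (H t)) :=
      continuous_iff_continuousAt.2 fun t => (hQd t).continuousAt
    have c3 : Continuous fun t => D.metricCoeff (x t) l :=
      (D.continuous_metricCoeff l).comp h.continuous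
    exact (continuous_const.mul c2).div (c1.mul c3) fun t => (mul_pos (hA t) (hg t)).ne'
  obtain ⟨φ, hφ, hφ'⟩ := _root_.exists_phase hcs hc
    (fun t => (hNd t).fun_mul (hκd t).hasDerivAt)
    (fun t ht => by
      have h1 : N t = 0 := (mul_eq_zero.1 ht).resolve_right (hκ0 t)
      rw [h1, zero_mul, add_zero]
      exact mul_ne_zero (hN0 t h1) (hκ0 t)) hρc
  refine ⟨φ, hφ, fun t => ?_⟩
  have h1 := (hφ' t).1
  rw [div_eq_iff hr.ne'] at h1
  change H t = _
  rw [angleParam]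
  linarith

end Phase

/-- The phase difference which corresponds to the half-period. -/
theorem phase_of_isHalfPeriod (D : LiouvilleManifold n) {γ : ℝ → D.Space} {b : ℕ → ℝ} {l : Idx n}
    (hpq : D.lower b l < D.upper b l) {φ φ' : ℝ → ℝ} (hφ : ∀ t, HasDerivAt φ (φ' t) t)
    (hφc : Continuous φ') (hpos : ∀ t, 0 ≤ φ' t)
    (hγ : ∀ t, D.coordFun l (γ t) = angleParam (D.lower b) (D.upper b) l (φ t)) {t : ℝ}
    (ht : D.IsHalfPeriod γ b l t) : φ t = φ 0 + 2 * Real.pi := by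
  have hr : 0 < (D.upper b l - D.lower b l) / 2 := by linarith
  have hderiv : ∀ s, |deriv (fun r => D.coordFun l (γ r)) s| =
      (D.upper b l - D.lower b l) / 2 * (|Real.sin (φ s)| * φ' s) := by
    intro s
    have h1 : HasDerivAt (fun r => angleParam (D.lower b) (D.upper b) l (φ r))
        ((D.upper b l - D.lower b l) / 2 * (-Real.sin (φ s) * φ' s)) s :=
      ((hφ s).cos.const_mul _).const_add _
    rw [show (fun r => D.coordFun l (γ r)) =
      fun r => angleParam (D.lower b) (D.upper b) l (φ r) from funext hγ, h1.deriv, abs_mul,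
      abs_mul, abs_neg, abs_of_pos hr, abs_of_nonneg (hpos s)]
  have hcov : ∫ s in (0 : ℝ)..t, |Real.sin (φ s)| * φ' s = ∫ θ in (φ 0)..(φ t), |Real.sin θ| :=
    intervalIntegral.integral_comp_mul_deriv (fun s _ => hφ s) hφc.continuousOn
      Real.continuous_sin.abs
  rw [IsHalfPeriod, totalVariation] at ht
  simp_rw [hderiv] at ht
  rw [intervalIntegral.integral_const_mul, hcov] at ht
  -- The prescribed variation is four times the amplitude `(upper - lower) / 2`.
  refine eq_add_two_pi_of_integral_abs_sin ?_
  refine mul_left_cancel₀ hr.ne' (ht.trans ?_)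
  change 2 * (D.upper b l - D.lower b l) = _
  ring

end LiouvilleManifold

/-! ### The order of the half-period times -/

open LiouvilleManifold in
theorem proposition5p1 (n : ℕ) (D : LiouvilleManifold n) (hD : D.MonotonicityCondition)
    (γ : ℝ → D.Space) (b : ℕ → ℝ) (hγ : D.IsGeodesicWithConstants γ b)
    (hb : ∀ i ∈ Finset.Icc 1 (n - 1), ∀ j ∈ Finset.Icc 1 (n - 1), i ≠ j → b i ≠ b j)
    (hab : ∀ i ∈ Finset.Icc 1 (n - 1), ∀ j ∈ Finset.range (n + 1), b i ≠ D.a j)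
    (t : ℕ → ℝ) (ht : ∀ i : Idx n, D.IsHalfPeriod γ b i (t i)) :
    ∀ i : ℕ, 1 ≤ i → i + 1 ≤ n → t (i + 1) < t i := by
  intro i hi hin
  by_contra hle
  push Not at hle
  obtain ⟨x, ξ, hlift, hx, hcon⟩ := hγ
  have hd : D.DistinctConstants b := ⟨hb, hab⟩
  have hcons := hlift.conserved hd hcon.1 hx
    (D.defect_eq_zero_of_hasConstants (by omega) hx (hlift.unit_speed 0 hx) hcon)
  have hreg : ∀ s, D.Regular (x s) := fun s => (hcons s).1
  have h₀ : ∀ s i, D.defect b (x s) (ξ s) i = 0 := fun s => (hcons s).2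
  have hmem : ∀ s, ∀ i : Idx n, D.f i (x s i) ∈ Set.Icc (D.lower b i) (D.upper b i) :=
    fun s i => f_mem_of_defect_eq_zero hcon.1 (hreg s) (h₀ s) i
  have hpq : ∀ l, D.lower b l < D.upper b l := D.lower_lt_upper hd (hmem 0)
  have hsep : ∀ k l, k < l → D.upper b l < D.lower b k := D.upper_lt_lower hd
  choose φ hφ hφH using hlift.exists_phase hd hcon.1 hreg h₀
  set ρ : Idx n → ℝ → ℝ := fun l s =>
    2 * √(gapFactor (D.lower b) (D.upper b) l (D.f l (x s l))) /
      (D.A (D.f l (x s l)) * D.metricCoeff (x s) l) with hρ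
  have hA : ∀ (l : Idx n) s, 0 < D.A (D.f l (x s l)) := fun l s => D.A_pos _ (D.f_mem_range l (x s l))
  have hg : ∀ l s, 0 < D.metricCoeff (x s) l := fun l s => D.metricCoeff_pos (hreg s) l
  have hQ : ∀ l s, 0 < √(gapFactor (D.lower b) (D.upper b) l (D.f l (x s l))) := fun l s =>
    Real.sqrt_pos.2 (gap_factor_pos hpq hsep l (hmem s l))
  have hρpos : ∀ l s, 0 < ρ l s := fun l s =>
    div_pos (mul_pos two_pos (hQ l s)) (mul_pos (hA l s) (hg l s))
  have hfc : ∀ l : Idx n, Continuous fun s => D.f l (x s l) := fun l =>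
    (D.f_differentiable l).continuous.comp ((continuous_apply l).comp hlift.continuous)
  have hρc : ∀ l, Continuous (ρ l) := by
    intro l
    have c1 : Continuous fun s => D.A (D.f l (x s l)) :=
      D.A_smooth.continuousOn.comp_continuous (hfc l) fun s => D.f_mem_range l (x s l)
    have c2 : Continuous fun s => √(gapFactor (D.lower b) (D.upper b) l (D.f l (x s l))) :=
      Real.continuous_sqrt.comp ((continuous_gapFactor l).comp (hfc l))
    have c3 : Continuous fun s => D.metricCoeff (x s) l :=
      (D.continuous_metricCoeff l).comp hlift.continuous
    exact (continuous_const.mul c2).div (c1.mul c3) fun s => (mul_pos (hA l s) (hg l s)).ne'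
  have hhalf : ∀ l : Idx n, φ l (t l) = φ l 0 + 2 * Real.pi := fun l =>
    D.phase_of_isHalfPeriod (hpq l) (hφ l) (hρc l) (fun s => (hρpos l s).le)
      (fun s => by rw [hlift.proj_eq, coordFun_proj, hφH]) (ht l)
  have hmono : ∀ l, StrictMono (φ l) := fun l =>
    strictMono_of_deriv_pos fun s => by rw [(hφ l s).deriv]; exact hρpos l s
  have hi' : i ∈ Finset.Icc 1 n := Finset.mem_Icc.2 ⟨hi, by omega⟩
  have hj' : i + 1 ∈ Finset.Icc 1 n := Finset.mem_Icc.2 ⟨by omega, hin⟩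
  refine phase_order_contradiction D.toLiouvilleData hD hpq hsep (D.a_le_lower b) (D.upper_le_a b)
    (fun l => φ l 0) (fun l => φ l (t i)) (fun G hG => ?_) (i := ⟨i, hi'⟩) (j := ⟨i + 1, hj'⟩) rfl
    (hhalf ⟨i, hi'⟩) (((hmono _).monotone hle).trans_eq (hhalf ⟨i + 1, hj'⟩))
  -- Back in the time variable, the speed of the phase cancels `A` and the root of the gap factor,
  -- leaving `2 G(f_l) / g_l`.
  have hcov : ∀ l : Idx n, ∫ θ in (φ l 0)..(φ l (t i)),
      G.eval (angleParam (D.lower b) (D.upper b) l θ) *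
        D.A (angleParam (D.lower b) (D.upper b) l θ) /
          √(gapFactor (D.lower b) (D.upper b) l (angleParam (D.lower b) (D.upper b) l θ)) =
      ∫ s in (0 : ℝ)..(t i), 2 * (G.eval (D.f l (x s l)) / D.metricCoeff (x s) l) := by
    intro l
    have hc := continuous_comp_angleParam hpq hsep l
      (D.continuousOn_weight (D.a_le_lower b) (D.upper_le_a b) l G)
    rw [← intervalIntegral.integral_comp_mul_deriv (fun s _ => hφ l s)
      (hρc l).continuousOn hc]
    refine intervalIntegral.integral_congr fun s _ => ?_
    simp only [Function.comp_apply]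
    rw [← hφH l s]
    have h1 := (hQ l s).ne'
    have h2 := (hA l s).ne'
    have h3 := (hg l s).ne'
    field_simp
  simp_rw [hcov, ← intervalIntegral.integral_const_mul]
  rw [← intervalIntegral.integral_finsetSum]
  · refine (intervalIntegral.integral_congr fun s _ => ?_).trans intervalIntegral.integral_zero
    -- At each time the alternating sum vanishes by partial fractions, since `g_l` is the absolute
    -- value of the node product.
    have h1 := sum_eval_div_abs_eq_zero (D.strictAnti_of_regular (hreg s)) hG
    simp only [← D.metricCoeff_eq_abs (hreg s)] at h1
    have h2 : ∑ l : Idx n, (-1 : ℝ) ^ (l : ℕ) *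
        (2 * (G.eval (D.f l (x s l)) / D.metricCoeff (x s) l)) =
        2 * ∑ l : Idx n, (-1) ^ (l : ℕ) * (G.eval (D.f l (x s l)) / D.metricCoeff (x s) l) := by
      rw [Finset.mul_sum]
      exact Finset.sum_congr rfl fun l _ => by ring
    exact h2.trans (by rw [h1, mul_zero])
  · intro l _
    refine Continuous.intervalIntegrable ?_ _ _
    have c3 : Continuous fun s => D.metricCoeff (x s) l :=
      (D.continuous_metricCoeff l).comp hlift.continuous
    exact continuous_const.mul (continuous_const.mul
      ((G.continuous.comp (hfc l)).div c3 fun s => (hg l s).ne'))
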